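/- **Setting.** Let $\mathrm K$ be a probability distribution on $\{1,2,\dots\}$ with $\mathrm K(n)=(1+o(1))\,c_K\,n^{-(1+\alpha)}$ as $n\to\infty$ for some $\alpha>0$ and $c_K>0$. Let $\tau=\{0=\tau_0<\tau_1<\tau_2<\cdots\}$ be the renewal process whose increments $\tau_i-\tau_{i-1}$ are i.i.d. with law $\mathrm K$; write $\mathbf E$ for its expectation and $\delta_n=\mathbf 1_{\{n\in\tau\}}$. Let $\omega=(\omega_i)_{i\ge 0}$ be a stationary and ergodic sequence of $\{-1,+1\}$-valued random variables, with law $\mathbb P$ (expectation $\mathbb E$), such that $\mathbb P(\omega_1=+1)>0$ and $\mathbb P(\omega_1=-1)>0$. For $\beta>0$ and $h\in\mathbb R$ define $$Z_{N,h}^{\omega,\beta}=\mathbf E\Big[\exp\Big(\sum_{n=1}^N(h+\beta\omega_n)\delta_n\Big)\Big],\qquad \mathtt F(\beta,h)=\lim_{N\to\infty}\frac1N\,\mathbb E\log Z_{N,h}^{\omega,\beta},$$ $$h_c(\beta)=\inf\{h\in\mathbb R:\ \mathtt F(\beta,h)>0\}\in[-\infty,+\infty].$$ For a finite set $\mathcal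 E$ of indices let $\mathfrak F_{\mathcal E}=\{\omega_i=+1\text{ for all }i\in\mathcal E\}$, and let $\theta^l\mathcal E=\{i+l:\ i\in\mathcal E\}$. **Theorem.** Assume that correlations are non-increasing: for all non-empty finite sets of indices $\mathcal E_1,\mathcal E_2$ with $\max\mathcal E_1<\min\mathcal E_2$ and all $k\ge0$, $$\mathbb P\big(\mathfrak F_{\mathcal E_1\cup\theta^{k+1}\mathcal E_2}\big)\le\mathbb P\big(\mathfrak F_{\mathcal E_1\cup\theta^{k}\mathcal E_2}\big).$$ Then $$h_c(\beta)=-\beta\ \text{ for all }\beta>0\quad\Longleftrightarrow\quad \liminf_{n\to\infty}-\frac1n\log\mathbb P(\omega_1=\cdots=\omega_n=+1)=0$$ (with $-\log 0=+\infty$). The right-hand condition is called infinite disorder. Moreover, in the absence of infinite disorder, $h_c(\beta)>-\beta$ for every $\beta>0$. -/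

import Mathlib

open MeasureTheory Filter Topology
open scoped Asymptotics

noncomputable section

namespace Pinning

/-! ### The renewal process -/

/-- Standing assumptions on the inter-arrival distribution `K`: it is a probability distribution on
`{1, 2, …}` (a `PMF` has total mass one, so the renewal is recurrent), with
`K(n) = (1 + o(1)) c_K / n ^ (1 + α)` for some `α > 0` and `c_K > 0`. -/
structure IsInterArrival (K : PMF ℕ) : Prop where
  zero : K 0 = 0
  tail : ∃ α cK : ℝ, 0 < α ∧ 0 < cK ∧
    (fun n : ℕ => (K n).toReal) ~[atTop] (fun n : ℕ => cK / (n : ℝ) ^ (1 + α))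

/-- The law of the sequence `(τ₁ - τ₀, τ₂ - τ₁, …)` of inter-arrival times: IID with law `K`. -/
def renewalLaw (K : PMF ℕ) : Measure (ℕ → ℕ) :=
  Measure.infinitePi (fun _ : ℕ => K.toMeasure)

/-- The renewal times `τ_k`, with `τ₀ = 0`, as a function of the inter-arrival times `ξ`. -/
def renewalTime (ξ : ℕ → ℕ) (k : ℕ) : ℕ := ∑ i ∈ Finset.range k, ξ i

open Classical in
/-- `δ_n`, the indicator of `n ∈ τ = {τ₀, τ₁, …}`. -/
def contact (ξ : ℕ → ℕ) (n : ℕ) : ℝ :=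
  if n ∈ Set.range (renewalTime ξ) then 1 else 0

/-! ### The disordered pinning model -/

/-- The partition function `Z_{N,h}^{w,β} = 𝐄[exp(∑_{n=1}^N (h + β w_n) δ_n)]` with free boundary
condition, for a fixed environment `w`. -/
def partitionFunction (K : PMF ℕ) (β h : ℝ) (w : ℕ → ℝ) (N : ℕ) : ℝ :=
  ∫ ξ, Real.exp (∑ n ∈ Finset.Icc 1 N, (h + β * w n) * contact ξ n) ∂(renewalLaw K)

variable {Ω : Type*} [MeasurableSpace Ω]

/-- The quenched free energy `F(β, h) = lim_{N → ∞} (1/N) 𝔼[log Z_{N,h}^{ω,β}]`. -/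
def freeEnergy (K : PMF ℕ) (P : Measure Ω) (ω : ℕ → Ω → ℝ) (β h : ℝ) : ℝ :=
  limUnder atTop (fun N : ℕ =>
    (1 / (N : ℝ)) * ∫ a, Real.log (partitionFunction K β h (fun i => ω i a) N) ∂P)

/-- The quenched critical point `h_c(β)`, possibly infinite: the threshold in `h` above which the
free energy is positive. -/
def criticalPoint (K : PMF ℕ) (P : Measure Ω) (ω : ℕ → Ω → ℝ) (β : ℝ) : EReal :=
  sInf ((fun h : ℝ => (h : EReal)) '' {h : ℝ | 0 < freeEnergy K P ω β h})

/-! ### The environment -/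

/-- The left shift on sequences. -/
def shift (x : ℕ → ℝ) : ℕ → ℝ := fun n => x (n + 1)

/-- `ω` is a `{-1, +1}`-valued, stationary and ergodic, non-trivial environment. (`Ergodic`
contains the invariance of the law of `ω` under the shift, that is, stationarity.) -/
structure IsEnvironment (P : Measure Ω) (ω : ℕ → Ω → ℝ) : Prop where
  measurable : ∀ i, Measurable (ω i)
  values : ∀ i, ∀ᵐ a ∂P, ω i a = 1 ∨ ω i a = -1
  ergodic : Ergodic shift (P.map (fun a i => ω i a))
  pos_plus : 0 < P {a | ω 1 a = 1}
  pos_minus : 0 < P {a | ω 1 a = -1}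

/-- The event that the environment is attractive (equal to `+1`) at all sites of `E`. -/
def allPlus (ω : ℕ → Ω → ℝ) (E : Finset ℕ) : Set Ω := {a | ∀ i ∈ E, ω i a = 1}

/-- The translate `θ^l E = {i + l : i ∈ E}`. -/
def translate (l : ℕ) (E : Finset ℕ) : Finset ℕ := E.image (fun i => i + l)

/-- Non-increasing correlations: if `max E₁ < min E₂`, the probability that the environment
is attractive on `E₁ ∪ θ^k E₂` is non-increasing in `k`. -/
def NonIncreasingCorrelations (P : Measure Ω) (ω : ℕ → Ω → ℝ) : Prop :=
  ∀ E₁ E₂ : Finset ℕ, E₁.Nonempty → E₂.Nonempty → (∀ i ∈ E₁, ∀ j ∈ E₂, i < j) →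
    ∀ k : ℕ, P (allPlus ω (E₁ ∪ translate (k + 1) E₂)) ≤ P (allPlus ω (E₁ ∪ translate k E₂))

/-- Infinite disorder: `liminf_{n → ∞} -(1/n) log ℙ(ω₁ = ⋯ = ω_n = +1) = 0`. The liminf is taken in
the extended reals, with `-log 0 = +∞`. -/
def InfiniteDisorder (P : Measure Ω) (ω : ℕ → Ω → ℝ) : Prop :=
  liminf (fun n : ℕ =>
    -(((1 / (n : ℝ) : ℝ) : EReal) * ENNReal.log (P (allPlus ω (Finset.Icc 1 n))))) atTop = 0

end Pinning

end

/-! For h ≤ -β every reward h + β ω_n is nonpositive, so Z_N ≤ 1, while a single jump past N keeps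
Z_N polynomially bounded below. Hence F = 0, and h_c ≥ -β always. The question is whether
localization starts immediately above -β.

Under infinite disorder it does. If h > -β, the homogeneous model with all sites attractive has
strictly positive free energy (`exists_one_lt_pinned_one`). Consider the trajectories that visit
only fully attractive blocks of length n. Such a block has probability p, at least exp(-ηn) for
infinitely many n, so the typical gap between them is of order n/p. Each block earns an amount
linear in n, with a rate independent of η. Reaching it costs about s log(1/p) ≤ sηn, because K
decays polynomially. For small η the gain wins, so F > 0 (`exists_goodBlocks_le_log_pinned`,
`le_freeEnergy_of_blocks`, `freeEnergy_pos_of_frequently`).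

Without infinite disorder, the interval [1,n] is attractive with probability at most C r^n for some
r < 1. Non-increasing correlations allow any finite set E to be compressed into an interval, so E is
attractive with probability at most C r^|E| (`measure_plusSet_le`). Given the contact set, the
expected Boltzmann weight is then at most C, uniformly, as long as h + β is small
(`integral_prod_exp_le`). The annealed partition function stays bounded, which forces F = 0 on a
right neighbourhood of -β.

The free energy is a `limUnder`, so convergence has to be proved first. The constrained partition
function is supermultiplicative, which gives a Fekete limit, and it differs from Z_N by polynomial
factors only (`exists_tendsto_integral_log`). -/

noncomputable section

namespace Pinning

/-! ### First-step decomposition of the partition function -/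

/-- Prepend a value to a sequence. -/
def consSeq (x : ℕ) (ξ : ℕ → ℕ) : ℕ → ℕ
  | 0 => x
  | i + 1 => ξ i

lemma measurable_consSeq : Measurable (fun p : ℕ × (ℕ → ℕ) => consSeq p.1 p.2) := by
  refine measurable_pi_iff.2 fun i => ?_
  cases i with
  | zero => exact measurable_fst
  | succ i => exact (measurable_pi_apply i).comp measurable_snd

instance (K : PMF ℕ) : IsProbabilityMeasure (renewalLaw K) := by
  unfold renewalLaw; infer_instance

/-- Prepending an independent copy to an i.i.d. sequence leaves its law unchanged. A product measure
is determined by its finite cylinders, and a cylinder factors according to whether it constrains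
coordinate 0. -/
lemma map_consSeq (K : PMF ℕ) :
    (K.toMeasure.prod (renewalLaw K)).map (fun p => consSeq p.1 p.2) = renewalLaw K := by
  refine Measure.eq_infinitePi _ fun s t ht => ?_
  have hs : MeasurableSet (Set.pi (s : Set ℕ) t) := .pi s.countable_toSet fun i _ => ht i
  rw [Measure.map_apply measurable_consSeq hs]
  let s' : Finset ℕ := s.preimage Nat.succ (Nat.succ_injective.injOn)
  by_cases h0 : 0 ∈ s
  · have hset : (fun p : ℕ × (ℕ → ℕ) => consSeq p.1 p.2) ⁻¹' Set.pi (s : Set ℕ) t =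
        t 0 ×ˢ Set.pi (s' : Set ℕ) (fun i => t (i + 1)) := by
      ext ⟨x, ξ⟩
      simp only [Set.mem_preimage, Set.mem_pi, Set.mem_prod, s', Finset.mem_coe,
        Finset.mem_preimage]
      constructor
      · exact fun H => ⟨H 0 h0, fun i hi => H (i + 1) hi⟩
      · rintro ⟨H0, H⟩ i hi
        cases i with
        | zero => exact H0
        | succ i => exact H i hi
    have hprod : ∏ i ∈ s, K.toMeasure (t i) =
        K.toMeasure (t 0) * ∏ i ∈ s', K.toMeasure (t (i + 1)) := by
      have : s = insert 0 (s'.image Nat.succ) := by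
        ext i
        cases i <;> simp [s', h0]
      rw [this, Finset.prod_insert (by simp), Finset.prod_image (by simp)]
    rw [hset, Measure.prod_prod, renewalLaw, Measure.infinitePi_pi _ (fun i _ => ht _), hprod]
  · have hset : (fun p : ℕ × (ℕ → ℕ) => consSeq p.1 p.2) ⁻¹' Set.pi (s : Set ℕ) t =
        Set.univ ×ˢ Set.pi (s' : Set ℕ) (fun i => t (i + 1)) := by
      ext ⟨x, ξ⟩
      simp only [Set.mem_preimage, Set.mem_pi, Set.mem_prod, s', Finset.mem_coe,
        Finset.mem_preimage, Set.mem_univ, true_and]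
      constructor
      · exact fun H i hi => H (i + 1) hi
      · intro H i hi
        cases i with
        | zero => exact absurd hi h0
        | succ i => exact H i hi
    have hprod : ∏ i ∈ s, K.toMeasure (t i) = ∏ i ∈ s', K.toMeasure (t (i + 1)) := by
      have : s = s'.image Nat.succ := by
        ext i
        cases i <;> simp [s', h0]
      conv_lhs => rw [this, Finset.prod_image (by simp)]
    rw [hset, Measure.prod_prod, renewalLaw, Measure.infinitePi_pi _ (fun i _ => ht _), hprod,
      measure_univ, one_mul]

lemma renewalTime_consSeq_succ (x : ℕ) (ξ : ℕ → ℕ) (k : ℕ) :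
    renewalTime (consSeq x ξ) (k + 1) = x + renewalTime ξ k := by
  simp [renewalTime, Finset.sum_range_succ', consSeq, add_comm]

lemma contact_zero (ξ : ℕ → ℕ) : contact ξ 0 = 1 :=
  if_pos ⟨0, by simp [renewalTime]⟩

lemma contact_consSeq_of_lt {x n : ℕ} (ξ : ℕ → ℕ) (hn : 0 < n) (h : n < x) :
    contact (consSeq x ξ) n = 0 := by
  refine if_neg ?_
  rintro ⟨k, hk⟩
  cases k with
  | zero => simp [renewalTime] at hk; omega
  | succ k => rw [renewalTime_consSeq_succ] at hk; omega

lemma contact_consSeq_add {x : ℕ} (ξ : ℕ → ℕ) (hx : 0 < x) (m : ℕ) :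
    contact (consSeq x ξ) (m + x) = contact ξ m := by
  have : m + x ∈ Set.range (renewalTime (consSeq x ξ)) ↔ m ∈ Set.range (renewalTime ξ) := by
    constructor
    · rintro ⟨k, hk⟩
      cases k with
      | zero => simp [renewalTime] at hk; omega
      | succ k => rw [renewalTime_consSeq_succ] at hk; exact ⟨k, by omega⟩
    · rintro ⟨k, rfl⟩
      exact ⟨k + 1, by rw [renewalTime_consSeq_succ, add_comm]⟩
  by_cases hm : m ∈ Set.range (renewalTime ξ)
  · rw [contact, contact, if_pos hm, if_pos (this.2 hm)]
  · rw [contact, contact, if_neg hm, if_neg fun H => hm (this.1 H)]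

lemma contact_nonneg (ξ : ℕ → ℕ) (n : ℕ) : 0 ≤ contact ξ n := by
  unfold contact; split_ifs <;> simp

lemma contact_le_one (ξ : ℕ → ℕ) (n : ℕ) : contact ξ n ≤ 1 := by
  unfold contact; split_ifs <;> simp

lemma measurable_contact (n : ℕ) : Measurable (fun ξ => contact ξ n) := by
  have hk (k : ℕ) : Measurable (fun ξ : ℕ → ℕ => renewalTime ξ k) :=
    Finset.measurable_sum _ fun i _ => measurable_pi_apply i
  have : MeasurableSet {ξ : ℕ → ℕ | n ∈ Set.range (renewalTime ξ)} := by
    have : {ξ : ℕ → ℕ | n ∈ Set.range (renewalTime ξ)} =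
        ⋃ k, (fun ξ => renewalTime ξ k) ⁻¹' {n} := by
      ext; simp
    rw [this]
    exact .iUnion fun k => hk k (measurableSet_singleton n)
  exact Measurable.ite this measurable_const measurable_const

/-- The Hamiltonian of the renewal trajectory with inter-arrival times `ξ`. -/
def energy (β h : ℝ) (w : ℕ → ℝ) (N : ℕ) (ξ : ℕ → ℕ) : ℝ :=
  ∑ n ∈ Finset.Icc 1 N, (h + β * w n) * contact ξ n

lemma measurable_energy (β h : ℝ) (w : ℕ → ℝ) (N : ℕ) : Measurable (energy β h w N) :=
  Finset.measurable_sum _ fun n _ => (measurable_contact n).const_mul _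

lemma abs_energy_le (β h : ℝ) (w : ℕ → ℝ) (N : ℕ) (ξ : ℕ → ℕ) :
    |energy β h w N ξ| ≤ ∑ n ∈ Finset.Icc 1 N, |h + β * w n| := by
  refine (Finset.abs_sum_le_sum_abs _ _).trans (Finset.sum_le_sum fun n _ => ?_)
  rw [abs_mul, abs_of_nonneg (contact_nonneg ξ n)]
  exact mul_le_of_le_one_right (abs_nonneg _) (contact_le_one ξ n)

lemma integrable_exp_energy {μ : Measure (ℕ → ℕ)} [IsFiniteMeasure μ] (β h : ℝ) (w : ℕ → ℝ)
    (N : ℕ) : Integrable (fun ξ => Real.exp (energy β h w N ξ)) μ := by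
  refine .of_bound (measurable_energy β h w N).exp.aestronglyMeasurable
    (Real.exp (∑ n ∈ Finset.Icc 1 N, |h + β * w n|)) (ae_of_all _ fun ξ => ?_)
  rw [Real.norm_eq_abs, Real.abs_exp]
  exact Real.exp_le_exp.2 ((le_abs_self _).trans (abs_energy_le β h w N ξ))

lemma energy_consSeq_of_lt (β h : ℝ) (w : ℕ → ℝ) {N x : ℕ} (hx : N < x) (ξ : ℕ → ℕ) :
    energy β h w N (consSeq x ξ) = 0 := by
  refine Finset.sum_eq_zero fun n hn => ?_
  rw [Finset.mem_Icc] at hn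
  rw [contact_consSeq_of_lt ξ hn.1 (by omega), mul_zero]

/-- The environment seen from site `j`. -/
def shiftBy (j : ℕ) (w : ℕ → ℝ) : ℕ → ℝ := fun n => w (n + j)

lemma energy_consSeq_of_le (β h : ℝ) (w : ℕ → ℝ) {N x : ℕ} (hx : 0 < x) (hxN : x ≤ N)
    (ξ : ℕ → ℕ) :
    energy β h w N (consSeq x ξ) =
      (h + β * w x) + energy β h (shiftBy x w) (N - x) ξ := by
  have hsub : Finset.Icc x N ⊆ Finset.Icc 1 N := Finset.Icc_subset_Icc_left hx
  rw [energy, ← Finset.sum_subset hsub, ← Finset.insert_Icc_succ_left_eq_Icc hxN,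
    Finset.sum_insert (by simp)]
  · congr 1
    · have := contact_consSeq_add ξ hx 0
      rw [zero_add, contact_zero] at this
      rw [this, mul_one]
    · have : Finset.Icc (Order.succ x) N =
          (Finset.Icc 1 (N - x)).map (addRightEmbedding x) := by
        rw [Finset.map_add_right_Icc, Nat.sub_add_cancel hxN, add_comm]; rfl
      rw [this, Finset.sum_map]
      simp [energy, shiftBy, contact_consSeq_add ξ hx]
  · intro n hn hn'
    rw [Finset.mem_Icc] at hn hn'
    rw [contact_consSeq_of_lt ξ hn.1 (by omega), mul_zero]

/-- Condition on the first jump: beyond N there is no contact and the weight is 1; at j ≤ N the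
process restarts in the shifted environment. Later inductions on N use this recursion in place of
the path measure. -/
lemma partitionFunction_eq (K : PMF ℕ) (hK : K 0 = 0) (β h : ℝ) (w : ℕ → ℝ) (N : ℕ) :
    partitionFunction K β h w N = K.toMeasure.real (Set.Ioi N) +
      ∑ j ∈ Finset.Icc 1 N, (K j).toReal * Real.exp (h + β * w j) *
        partitionFunction K β h (shiftBy j w) (N - j) := by
  have h1 : partitionFunction K β h w N =
      ∫ x, ∫ ξ, Real.exp (energy β h w N (consSeq x ξ)) ∂(renewalLaw K) ∂K.toMeasure := by
    have hint : Integrable (fun p : ℕ × (ℕ → ℕ) => Real.exp (energy β h w N (consSeq p.1 p.2)))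
        (K.toMeasure.prod (renewalLaw K)) := by
      have := integrable_exp_energy (μ := renewalLaw K) β h w N
      rw [← map_consSeq K] at this
      exact this.comp_measurable measurable_consSeq
    have hmap := integral_map (μ := K.toMeasure.prod (renewalLaw K))
      (f := fun ξ => Real.exp (energy β h w N ξ)) measurable_consSeq.aemeasurable
      (measurable_energy β h w N).exp.aestronglyMeasurable
    rw [map_consSeq] at hmap
    rw [← integral_prod _ hint, ← hmap]
    rfl
  have h0 : ∀ᵐ x ∂K.toMeasure, x ≠ 0 := by
    rw [ae_iff]
    simp only [ne_eq, not_not, Set.ofPred_eq_eq_singleton]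
    rw [K.toMeasure_apply_singleton _ (measurableSet_singleton 0), hK]
  have h2 : (fun x => ∫ ξ, Real.exp (energy β h w N (consSeq x ξ)) ∂(renewalLaw K))
      =ᵐ[K.toMeasure] fun x => (Set.Ioi N).indicator (fun _ => (1 : ℝ)) x +
        ∑ j ∈ Finset.Icc 1 N, ({j} : Set ℕ).indicator (fun _ => Real.exp (h + β * w j) *
        partitionFunction K β h (shiftBy j w) (N - j)) x := by
    filter_upwards [h0] with x hx
    rcases lt_or_ge N x with hxN | hxN
    · rw [Finset.sum_eq_zero]
      · simp [energy_consSeq_of_lt β h w hxN, hxN]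
      · intro j hj
        rw [Finset.mem_Icc] at hj
        exact Set.indicator_of_notMem (by simp; omega) _
    · rw [Finset.sum_eq_single x]
      · rw [Set.indicator_of_notMem (by simpa using hxN), zero_add,
          Set.indicator_of_mem (Set.mem_singleton x)]
        simp_rw [energy_consSeq_of_le β h w (Nat.pos_of_ne_zero hx) hxN, Real.exp_add]
        rw [integral_const_mul]
        rfl
      · intro j _ hjx
        exact Set.indicator_of_notMem (by simpa using hjx.symm) _
      · intro hx'
        rw [Finset.mem_Icc] at hx'
        omega
  have hi (s : Set ℕ) (c : ℝ) : Integrable (s.indicator fun _ => c) K.toMeasure :=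
    (integrable_const c).indicator (Set.to_countable s).measurableSet
  rw [h1, integral_congr_ae h2, integral_add (hi _ _) (integrable_finsetSum _ fun j _ => hi _ _),
    integral_finsetSum _ fun j _ => hi _ _,
    integral_indicator_const _ (Set.to_countable _).measurableSet, smul_eq_mul, mul_one]
  congr 1
  refine Finset.sum_congr rfl fun j _ => ?_
  rw [integral_indicator_const _ (measurableSet_singleton j), smul_eq_mul, Measure.real,
    K.toMeasure_apply_singleton _ (measurableSet_singleton j), mul_assoc]

/-! ### The constrained partition function -/

/-- The partition function `𝐄[exp(∑_{n=1}^N (h + β w_n) δ_n) δ_N]` constrained to a contact at `N`,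
given by its first-step decomposition. -/
def pinned (K : PMF ℕ) (β h : ℝ) : (N : ℕ) → (ℕ → ℝ) → ℝ
  | 0, _ => 1
  | N + 1, w => ∑ i : Fin (N + 1), (K (i + 1)).toReal * Real.exp (h + β * w (i + 1)) *
      pinned K β h (N - i) (shiftBy (i + 1) w)
decreasing_by omega

variable {K : PMF ℕ} {β h : ℝ}

lemma shiftBy_shiftBy (i j : ℕ) (w : ℕ → ℝ) : shiftBy i (shiftBy j w) = shiftBy (i + j) w := by
  funext n; simp [shiftBy, add_assoc]

@[simp] lemma shiftBy_zero (w : ℕ → ℝ) : shiftBy 0 w = w := rfl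

@[simp] lemma pinned_zero (w : ℕ → ℝ) : pinned K β h 0 w = 1 := by rw [pinned]

lemma pinned_eq {N : ℕ} (hN : 0 < N) (w : ℕ → ℝ) :
    pinned K β h N w = ∑ j ∈ Finset.Icc 1 N, (K j).toReal * Real.exp (h + β * w j) *
      pinned K β h (N - j) (shiftBy j w) := by
  obtain ⟨N, rfl⟩ : ∃ M, N = M + 1 := ⟨N - 1, by omega⟩
  rw [pinned, Fin.sum_univ_eq_sum_range (fun i => (K (i + 1)).toReal *
    Real.exp (h + β * w (i + 1)) * pinned K β h (N - i) (shiftBy (i + 1) w)) (N + 1),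
    show Finset.Icc 1 (N + 1) = Finset.Ico (0 + 1) (N + 1 + 1) by ext; simp,
    ← Finset.sum_Ico_add', Finset.range_eq_Ico]
  simp_rw [Nat.add_sub_add_right]

lemma weight_nonneg (j : ℕ) (w : ℕ → ℝ) : 0 ≤ (K j).toReal * Real.exp (h + β * w j) := by
  positivity

lemma pinned_nonneg (N : ℕ) (w : ℕ → ℝ) : 0 ≤ pinned K β h N w := by
  induction N using Nat.strong_induction_on generalizing w with
  | _ N ih =>
    rcases Nat.eq_zero_or_pos N with rfl | hN
    · simp
    · rw [pinned_eq hN]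
      refine Finset.sum_nonneg fun j hj => mul_nonneg (weight_nonneg j w) (ih _ ?_ _)
      rw [Finset.mem_Icc] at hj; omega

lemma measurable_shiftBy (j : ℕ) : Measurable (shiftBy j) :=
  measurable_pi_iff.2 fun n => measurable_pi_apply (n + j)

lemma measurable_weight (j : ℕ) :
    Measurable (fun w : ℕ → ℝ => (K j).toReal * Real.exp (h + β * w j)) := by
  fun_prop

lemma measurable_pinned (N : ℕ) : Measurable (pinned K β h N) := by
  induction N using Nat.strong_induction_on with
  | _ N ih =>
    rcases Nat.eq_zero_or_pos N with rfl | hN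
    · simp_rw [funext (pinned_zero (K := K) (β := β) (h := h))]
      exact measurable_const
    · rw [funext (pinned_eq hN)]
      refine Finset.measurable_sum _ fun j hj => (measurable_weight j).mul
        ((ih _ ?_).comp (measurable_shiftBy j))
      rw [Finset.mem_Icc] at hj; omega

lemma measurable_partitionFunction (hK : K 0 = 0) (N : ℕ) :
    Measurable (fun w => partitionFunction K β h w N) := by
  induction N using Nat.strong_induction_on with
  | _ N ih =>
    simp_rw [partitionFunction_eq K hK β h _ N]
    refine measurable_const.add (Finset.measurable_sum _ fun j hj => (measurable_weight j).mul
        ((ih _ ?_).comp (measurable_shiftBy j)))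
    rw [Finset.mem_Icc] at hj; omega

lemma partitionFunction_nonneg (w : ℕ → ℝ) (N : ℕ) : 0 ≤ partitionFunction K β h w N :=
  integral_nonneg fun _ => (Real.exp_pos _).le

lemma tail_le_partitionFunction (hK : K 0 = 0) (w : ℕ → ℝ) (N : ℕ) :
    K.toMeasure.real (Set.Ioi N) ≤ partitionFunction K β h w N := by
  rw [partitionFunction_eq K hK]
  exact le_add_of_nonneg_right (Finset.sum_nonneg fun j _ =>
    mul_nonneg (weight_nonneg j w) (partitionFunction_nonneg _ _))

lemma pinned_le_partitionFunction (hK : K 0 = 0) (N : ℕ) (w : ℕ → ℝ) :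
    pinned K β h N w ≤ partitionFunction K β h w N := by
  induction N using Nat.strong_induction_on generalizing w with
  | _ N ih =>
    rcases Nat.eq_zero_or_pos N with rfl | hN
    · simp [partitionFunction]
    · rw [pinned_eq hN, partitionFunction_eq K hK]
      refine le_add_of_nonneg_of_le measureReal_nonneg (Finset.sum_le_sum fun j hj =>
        mul_le_mul_of_nonneg_left (ih _ ?_ _) (weight_nonneg j w))
      rw [Finset.mem_Icc] at hj; omega

lemma partitionFunction_le_one {w : ℕ → ℝ} (hw : ∀ n, h + β * w n ≤ 0) (N : ℕ) :
    partitionFunction K β h w N ≤ 1 := by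
  have : partitionFunction K β h w N ≤ ∫ _, (1 : ℝ) ∂(renewalLaw K) := by
    refine integral_mono (integrable_exp_energy β h w N) (integrable_const _) fun ξ => ?_
    exact Real.exp_le_one_iff.2 (Finset.sum_nonpos fun n _ =>
      mul_nonpos_of_nonpos_of_nonneg (hw n) (contact_nonneg ξ n))
  simpa using this

lemma partitionFunction_le_exp {B : ℝ} {w : ℕ → ℝ} (hw : ∀ n, |h + β * w n| ≤ B) (N : ℕ) :
    partitionFunction K β h w N ≤ Real.exp (B * N) := by
  have : partitionFunction K β h w N ≤ ∫ _, Real.exp (B * N) ∂(renewalLaw K) := by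
    refine integral_mono (integrable_exp_energy β h w N) (integrable_const _) fun ξ => ?_
    refine Real.exp_le_exp.2 ((le_abs_self _).trans ((abs_energy_le β h w N ξ).trans ?_))
    refine (Finset.sum_le_card_nsmul _ _ B fun n _ => hw n).trans_eq ?_
    simp [mul_comm]
  simpa using this

/-- Forcing a contact at N discards trajectories of nonnegative weight. In the recursion this drops
the first steps that land beyond N. -/
lemma pinned_mul_le (N M : ℕ) (w : ℕ → ℝ) :
    pinned K β h N w * pinned K β h M (shiftBy N w) ≤ pinned K β h (N + M) w := by
  induction N using Nat.strong_induction_on generalizing w with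
  | _ N ih =>
    rcases Nat.eq_zero_or_pos N with rfl | hN
    · simp
    · rw [pinned_eq hN, pinned_eq (Nat.add_pos_left hN M), Finset.sum_mul]
      refine (Finset.sum_le_sum fun j hj => ?_).trans
        (Finset.sum_le_sum_of_subset_of_nonneg
          (Finset.Icc_subset_Icc_right (Nat.le_add_right N M)) fun j _ _ =>
          mul_nonneg (weight_nonneg j w) (pinned_nonneg _ _))
      rw [Finset.mem_Icc] at hj
      rw [mul_assoc]
      refine mul_le_mul_of_nonneg_left ?_ (weight_nonneg j w)
      have := ih (N - j) (by omega) (shiftBy j w)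
      rwa [shiftBy_shiftBy, Nat.sub_add_cancel hj.2, ← Nat.sub_add_comm hj.2] at this

lemma weight_le_pinned {N : ℕ} (hN : 0 < N) (w : ℕ → ℝ) :
    (K N).toReal * Real.exp (h + β * w N) ≤ pinned K β h N w := by
  rw [pinned_eq hN]
  have := Finset.single_le_sum (f := fun j => (K j).toReal * Real.exp (h + β * w j) *
      pinned K β h (N - j) (shiftBy j w))
    (fun j _ => mul_nonneg (weight_nonneg j w) (pinned_nonneg _ _))
    (Finset.mem_Icc.2 ⟨hN, le_rfl⟩)
  simpa using this

/-- Replace the final jump past N by a jump landing exactly at N + n₀; its length is at least n₀,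
where K is bounded below. The range R is kept apart from N so that κ stays fixed along the
induction. -/
lemma mul_partitionFunction_le_pinned (hK : K 0 = 0) {B κ : ℝ} (hκ : 0 ≤ κ) {n₀ R : ℕ}
    (hn₀ : 0 < n₀)
    (hle : ∀ m, n₀ ≤ m → m ≤ R + n₀ → κ ≤ (K m).toReal * Real.exp (-B)) (N : ℕ) (hNR : N ≤ R)
    {w : ℕ → ℝ} (hw : ∀ n, |h + β * w n| ≤ B) :
    κ * partitionFunction K β h w N ≤ pinned K β h (N + n₀) w := by
  induction N using Nat.strong_induction_on generalizing w with
  | _ N ih =>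
    rw [pinned_eq (Nat.add_pos_right N hn₀), partitionFunction_eq K hK, mul_add, Finset.mul_sum]
    have hsub : insert (N + n₀) (Finset.Icc 1 N) ⊆ Finset.Icc 1 (N + n₀) := by
      intro j; simp only [Finset.mem_insert, Finset.mem_Icc]; omega
    refine le_trans ?_ (Finset.sum_le_sum_of_subset_of_nonneg hsub fun j _ _ =>
          mul_nonneg (weight_nonneg j w) (pinned_nonneg _ _))
    rw [Finset.sum_insert (by simp; omega)]
    refine add_le_add ?_ (Finset.sum_le_sum fun j hj => ?_)
    · rw [Nat.sub_self, pinned_zero, mul_one]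
      refine (mul_le_of_le_one_right hκ measureReal_le_one).trans ?_
      refine (hle (N + n₀) (by omega) (by omega)).trans ?_
      gcongr
      exact (abs_le.1 (hw _)).1
    · rw [Finset.mem_Icc] at hj
      rw [mul_left_comm]
      refine mul_le_mul_of_nonneg_left ?_ (weight_nonneg j w)
      have := ih (N - j) (by omega) (by omega) (w := shiftBy j w) (fun n => hw (n + j))
      rwa [← Nat.sub_add_comm hj.2] at this

/-! ### Existence of the free energy -/

/-- The asymptotics of K enter the proof only through this polynomial lower bound. -/
lemma IsInterArrival.exists_lower_bound (hK : IsInterArrival K) :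
    ∃ s c : ℝ, 0 < s ∧ 0 < c ∧ ∃ n₀ : ℕ, 0 < n₀ ∧
      ∀ n, n₀ ≤ n → c * (n : ℝ) ^ (-s) ≤ (K n).toReal := by
  obtain ⟨α, cK, hα, hc, hequiv⟩ := hK.tail
  refine ⟨1 + α, cK / 2, by linarith, by linarith, ?_⟩
  have hpos : ∀ᶠ n : ℕ in atTop, 0 < cK / (n : ℝ) ^ (1 + α) := by
    filter_upwards [eventually_gt_atTop 0] with n hn
    positivity
  have hlim := (Asymptotics.isEquivalent_iff_tendsto_one
    (hpos.mono fun n hn => hn.ne')).1 hequiv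
  have hev := hlim.eventually (lt_mem_nhds (show (1 / 2 : ℝ) < 1 by norm_num))
  obtain ⟨n₀, hn₀⟩ := eventually_atTop.1 (hev.and hpos)
  refine ⟨n₀ + 1, by omega, fun n hn => ?_⟩
  obtain ⟨h1, h2⟩ := hn₀ n (by omega)
  rw [Pi.div_apply, lt_div_iff₀ h2] at h1
  rw [Real.rpow_neg n.cast_nonneg]
  refine le_of_eq_of_le ?_ h1.le
  ring

/-- Subtract m repeatedly until the remainder lies in [m, 2m). It is not reduced further because
superadditivity is available only from n₀ on; C absorbs the remainders. -/
lemma exists_le_of_superadditive {a : ℕ → ℝ} {n₀ : ℕ}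
    (hadd : ∀ N M, n₀ ≤ N → n₀ ≤ M → a N + a M ≤ a (N + M)) {m : ℕ} (hm : n₀ ≤ m)
    (hm0 : 0 < m) : ∃ C, ∀ N, m ≤ N → N * (a m / m) - C ≤ a N := by
  refine ⟨∑ r ∈ Finset.range (2 * m), |a r - r * (a m / m)|, fun N => ?_⟩
  induction N using Nat.strong_induction_on with
  | _ N ih =>
    intro hN
    rcases lt_or_ge N (2 * m) with h2 | h2
    · have := Finset.single_le_sum (f := fun r : ℕ => |a r - r * (a m / m)|)
        (fun _ _ => abs_nonneg _) (Finset.mem_range.2 h2)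
      have := neg_abs_le (a N - N * (a m / m))
      beta_reduce at *
      linarith
    · have h1 := ih (N - m) (by omega) (by omega)
      have h2 := hadd (N - m) m (by omega) hm
      rw [Nat.sub_add_cancel hN] at h2
      rw [Nat.cast_sub hN] at h1
      have : (m : ℝ) * (a m / m) = a m := by field_simp
      linarith

/-- Fekete's lemma with superadditivity from n₀ on, since K may vanish at smaller lengths. The limit
is the supremum, so every finite volume gives a lower bound for it. -/
lemma tendsto_of_superadditive {a : ℕ → ℝ} {n₀ : ℕ} (hn₀ : 0 < n₀)
    (hadd : ∀ N M, n₀ ≤ N → n₀ ≤ M → a N + a M ≤ a (N + M)) {B : ℝ}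
    (hB : ∀ N, n₀ ≤ N → a N ≤ B * N) :
    ∃ l, Tendsto (fun N => a N / N) atTop (𝓝 l) ∧ ∀ N, n₀ ≤ N → a N / N ≤ l := by
  let S : Set ℝ := (fun N : ℕ => a N / N) '' Set.Ici n₀
  have hS : BddAbove S := by
    refine ⟨B, ?_⟩
    rintro _ ⟨N, hN, rfl⟩
    have : (0 : ℝ) < N := by exact_mod_cast hn₀.trans_le hN
    exact (div_le_iff₀ this).2 (hB N hN)
  have hle : ∀ N, n₀ ≤ N → a N / N ≤ sSup S := fun N hN => le_csSup hS ⟨N, hN, rfl⟩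
  refine ⟨sSup S, ?_, hle⟩
  rw [tendsto_order]
  refine ⟨fun x hx => ?_, fun x hx => ?_⟩
  · obtain ⟨_, ⟨m, hm, rfl⟩, hmx⟩ := exists_lt_of_lt_csSup (Set.nonempty_Ici.image _) hx
    obtain ⟨C, hC⟩ := exists_le_of_superadditive hadd hm (hn₀.trans_le hm)
    have hlim : Tendsto (fun N : ℕ => a m / m - C / N) atTop (𝓝 (a m / m - 0)) :=
      tendsto_const_nhds.sub (tendsto_const_nhds.div_atTop tendsto_natCast_atTop_atTop)
    rw [sub_zero] at hlim
    filter_upwards [hlim.eventually (lt_mem_nhds hmx), eventually_ge_atTop m] with N h1 h2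
    have hN : (0 : ℝ) < N := by exact_mod_cast (hn₀.trans_le hm).trans_le h2
    refine h1.trans_le ((le_div_iff₀ hN).2 (le_of_eq_of_le ?_ (hC N h2)))
    field_simp
  · filter_upwards [eventually_ge_atTop n₀] with N hN
    exact (hle N hN).trans_lt hx

lemma tendsto_log_add_div (k : ℕ) :
    Tendsto (fun N : ℕ => Real.log ((N + k : ℕ) : ℝ) / N) atTop (𝓝 0) := by
  have h1 : Tendsto (fun N : ℕ => Real.log ((N + k : ℕ) : ℝ) / ((N + k : ℕ) : ℝ)) atTop (𝓝 0) :=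
    (Real.isLittleO_log_id_atTop.tendsto_div_nhds_zero.comp
      tendsto_natCast_atTop_atTop).comp (tendsto_add_atTop_nat k)
  have h2 : Tendsto (fun N : ℕ => 1 + (k : ℝ) / N) atTop (𝓝 (1 + 0)) :=
    tendsto_const_nhds.add (tendsto_const_nhds.div_atTop tendsto_natCast_atTop_atTop)
  have h3 := h1.mul h2
  rw [zero_mul] at h3
  refine h3.congr' ?_
  filter_upwards [eventually_gt_atTop 0] with N hN
  have : (0 : ℝ) < N := by exact_mod_cast hN
  push_cast
  field_simp

lemma shift_iterate (j : ℕ) (w : ℕ → ℝ) : shift^[j] w = shiftBy j w := by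
  induction j generalizing w with
  | zero => rfl
  | succ j ih => rw [Function.iterate_succ_apply, ih]; funext n; simp [shiftBy, shift]; congr 1

lemma measurePreserving_shiftBy {Q : Measure (ℕ → ℝ)} (hQ : MeasurePreserving shift Q Q)
    (j : ℕ) : MeasurePreserving (shiftBy j) Q Q := by
  have := hQ.iterate j
  rwa [funext (shift_iterate j)] at this

lemma pinned_pos {n : ℕ} (hn : 0 < n) (hKn : 0 < (K n).toReal) (w : ℕ → ℝ) :
    0 < pinned K β h n w :=
  (mul_pos hKn (Real.exp_pos _)).trans_le (weight_le_pinned hn w)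

section

variable {Q : Measure (ℕ → ℝ)} [IsProbabilityMeasure Q] {B : ℝ}

lemma integrable_log_of_le {f : (ℕ → ℝ) → ℝ} (hf : Measurable f) {x y : ℝ} (hx : 0 < x)
    (h1 : ∀ᵐ w ∂Q, x ≤ f w ∧ f w ≤ y) : Integrable (fun w => Real.log (f w)) Q := by
  refine .of_mem_Icc (Real.log x) (Real.log y) hf.log.aemeasurable ?_
  filter_upwards [h1] with w hw
  exact ⟨Real.log_le_log hx hw.1, Real.log_le_log (hx.trans_le hw.1) hw.2⟩

variable (hbd : ∀ᵐ w ∂Q, ∀ n, |h + β * w n| ≤ B)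
include hbd

omit [IsProbabilityMeasure Q] in
lemma ae_le_pinned {n : ℕ} (hn : 0 < n) :
    ∀ᵐ w ∂Q, (K n).toReal * Real.exp (-B) ≤ pinned K β h n w := by
  filter_upwards [hbd] with w hw
  refine le_trans ?_ (weight_le_pinned hn w)
  gcongr
  exact (abs_le.1 (hw _)).1

lemma integrable_log_pinned (hK : K 0 = 0) {n : ℕ} (hn : 0 < n) (hKn : 0 < (K n).toReal) :
    Integrable (fun w => Real.log (pinned K β h n w)) Q := by
  refine integrable_log_of_le (measurable_pinned n) (x := (K n).toReal * Real.exp (-B))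
    (y := Real.exp (B * n)) (by positivity) ?_
  filter_upwards [ae_le_pinned hbd hn, hbd] with w h1 hw
  exact ⟨h1, (pinned_le_partitionFunction hK n w).trans (partitionFunction_le_exp hw n)⟩

lemma integrable_log_partitionFunction (hK : K 0 = 0) {n : ℕ} (hn : 0 < n)
    (hKn : 0 < (K n).toReal) : Integrable (fun w => Real.log (partitionFunction K β h w n)) Q := by
  refine integrable_log_of_le (measurable_partitionFunction hK n)
    (x := (K n).toReal * Real.exp (-B)) (y := Real.exp (B * n)) (by positivity) ?_
  filter_upwards [ae_le_pinned hbd hn, hbd] with w h1 hw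
  exact ⟨h1.trans (pinned_le_partitionFunction hK n w), partitionFunction_le_exp hw n⟩

lemma integral_log_pinned_add_le (hQ : MeasurePreserving shift Q Q) (hK : K 0 = 0) {n m : ℕ}
    (hn : 0 < n) (hm : 0 < m) (hKn : 0 < (K n).toReal) (hKm : 0 < (K m).toReal)
    (hKnm : 0 < (K (n + m)).toReal) :
    ∫ w, Real.log (pinned K β h n w) ∂Q + ∫ w, Real.log (pinned K β h m w) ∂Q ≤
      ∫ w, Real.log (pinned K β h (n + m) w) ∂Q := by
  have hmp := measurePreserving_shiftBy hQ n
  have hi := integrable_log_pinned hbd (K := K) hK hm hKm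
  have h1 : ∫ w, Real.log (pinned K β h m (shiftBy n w)) ∂Q =
      ∫ w, Real.log (pinned K β h m w) ∂Q := by
    have := integral_map (μ := Q) (f := fun w => Real.log (pinned K β h m w))
      hmp.measurable.aemeasurable
      (measurable_pinned m).log.aestronglyMeasurable
    rw [← this, hmp.map_eq]
  have hi' : Integrable (fun w => Real.log (pinned K β h m (shiftBy n w))) Q :=
    hmp.integrable_comp_of_integrable hi
  rw [← h1, ← integral_add (integrable_log_pinned hbd hK hn hKn) hi']
  refine integral_mono ((integrable_log_pinned hbd hK hn hKn).add hi')
    (integrable_log_pinned hbd hK (by omega) hKnm) fun w => ?_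
  have p1 := pinned_pos (β := β) (h := h) hn hKn w
  have p2 := pinned_pos (β := β) (h := h) hm hKm (shiftBy n w)
  simp only
  rw [← Real.log_mul p1.ne' p2.ne']
  exact Real.log_le_log (mul_pos p1 p2) (pinned_mul_le n m w)

/-- The free energy exists, and dominates the finite-volume pinned free energies. -/
lemma exists_tendsto_integral_log (hQ : MeasurePreserving shift Q Q) (hK : K 0 = 0)
    {s c : ℝ} (hs : 0 < s) (hc : 0 < c) {n₀ : ℕ} (hn₀ : 0 < n₀)
    (hlow : ∀ n, n₀ ≤ n → c * (n : ℝ) ^ (-s) ≤ (K n).toReal) :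
    ∃ l, Tendsto (fun N : ℕ => 1 / (N : ℝ) * ∫ w, Real.log (partitionFunction K β h w N) ∂Q)
      atTop (𝓝 l) ∧
      ∀ N : ℕ, n₀ ≤ N → (∫ w, Real.log (pinned K β h N w) ∂Q) / N ≤ l := by
  have hKpos : ∀ n, n₀ ≤ n → 0 < (K n).toReal := fun n hn => by
    have : (0 : ℝ) < n := by exact_mod_cast hn₀.trans_le hn
    exact lt_of_lt_of_le (by positivity) (hlow n hn)
  have hpos : ∀ n, n₀ ≤ n → 0 < n := fun n hn => hn₀.trans_le hn
  set a : ℕ → ℝ := fun N => ∫ w, Real.log (pinned K β h N w) ∂Q with ha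
  set f : ℕ → ℝ := fun N => ∫ w, Real.log (partitionFunction K β h w N) ∂Q with hf
  obtain ⟨l, hl, hle⟩ := tendsto_of_superadditive (a := a) hn₀
    (fun N M hN hM => integral_log_pinned_add_le hbd hQ hK (hpos N hN) (hpos M hM) (hKpos N hN)
      (hKpos M hM) (hKpos _ (by omega))) (B := B) (fun N hN => by
      have h1 : a N ≤ ∫ _, B * N ∂Q := by
        refine integral_mono_ae (integrable_log_pinned hbd hK (hpos N hN) (hKpos N hN))
          (integrable_const _) ?_
        filter_upwards [hbd] with w hw
        rw [Real.log_le_iff_le_exp (pinned_pos (hpos N hN) (hKpos N hN) w)]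
        exact (pinned_le_partitionFunction hK N w).trans (partitionFunction_le_exp hw N)
      simpa using h1)
  refine ⟨l, ?_, hle⟩
  have hupper : ∀ N, n₀ ≤ N →
      f N ≤ a (N + n₀) + (s * Real.log ((N + n₀ : ℕ) : ℝ) + (B - Real.log c)) := by
    intro N hN
    have hx : (0 : ℝ) < ((N + n₀ : ℕ) : ℝ) := by exact_mod_cast Nat.add_pos_right N hn₀
    -- The worst cost of the redirected final jump, over all lengths up to N + n₀; its logarithm is
    -- O(log N), hence negligible after division by N.
    set κ := c * ((N + n₀ : ℕ) : ℝ) ^ (-s) * Real.exp (-B) with hκdef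
    have hκ : 0 < κ := by positivity
    have hlogκ : Real.log κ = -(s * Real.log ((N + n₀ : ℕ) : ℝ) + (B - Real.log c)) := by
      rw [hκdef, Real.log_mul (by positivity) (Real.exp_pos _).ne',
        Real.log_mul hc.ne' (by positivity), Real.log_rpow hx, Real.log_exp]
      ring
    have hi1 := integrable_log_partitionFunction (β := β) (h := h) hbd hK (hpos N hN) (hKpos N hN)
    have hi2 := integrable_log_pinned (β := β) (h := h) hbd hK (n := N + n₀) (by omega)
      (hKpos _ (by omega))
    have h1 : ∫ w, (Real.log κ + Real.log (partitionFunction K β h w N)) ∂Q ≤ a (N + n₀) := by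
      refine integral_mono_ae ((integrable_const _).add hi1) hi2 ?_
      filter_upwards [hbd] with w hw
      have hp : 0 < partitionFunction K β h w N :=
        (pinned_pos (hpos N hN) (hKpos N hN) w).trans_le (pinned_le_partitionFunction hK N w)
      rw [← Real.log_mul hκ.ne' hp.ne']
      refine Real.log_le_log (mul_pos hκ hp)
        (mul_partitionFunction_le_pinned hK hκ.le hn₀ (R := N) (fun m hm hmN => ?_) N le_rfl hw)
      refine mul_le_mul_of_nonneg_right (le_trans ?_ (hlow m hm)) (Real.exp_pos _).le
      refine mul_le_mul_of_nonneg_left ?_ hc.le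
      have hm' : (0 : ℝ) < m := by exact_mod_cast hpos m hm
      exact Real.rpow_le_rpow_of_nonpos hm' (by exact_mod_cast hmN) (by linarith)
    rw [integral_add (integrable_const _) hi1] at h1
    simp only [integral_const, probReal_univ, smul_eq_mul, one_mul] at h1
    change Real.log κ + f N ≤ a (N + n₀) at h1
    linarith
  have hlower : ∀ N, n₀ ≤ N → a N ≤ f N := fun N hN =>
    integral_mono (integrable_log_pinned hbd hK (hpos N hN) (hKpos N hN))
      (integrable_log_partitionFunction hbd hK (hpos N hN) (hKpos N hN)) fun w =>
      Real.log_le_log (pinned_pos (hpos N hN) (hKpos N hN) w) (pinned_le_partitionFunction hK N w)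
  have hlim2 : Tendsto (fun N : ℕ => a (N + n₀) / ((N + n₀ : ℕ) : ℝ) * (1 + (n₀ : ℝ) / N) +
      (s * (Real.log ((N + n₀ : ℕ) : ℝ) / N) + (B - Real.log c) / N)) atTop
      (𝓝 (l * (1 + 0) + (s * 0 + 0))) := by
    have e1 : Tendsto (fun N : ℕ => (n₀ : ℝ) / N) atTop (𝓝 0) :=
      tendsto_const_nhds.div_atTop tendsto_natCast_atTop_atTop
    have e2 : Tendsto (fun N : ℕ => (B - Real.log c) / N) atTop (𝓝 0) :=
      tendsto_const_nhds.div_atTop tendsto_natCast_atTop_atTop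
    exact ((hl.comp (tendsto_add_atTop_nat n₀)).mul (tendsto_const_nhds.add e1)).add
      (((tendsto_log_add_div n₀).const_mul s).add e2)
  simp only [add_zero, mul_zero, mul_one] at hlim2
  refine tendsto_of_tendsto_of_tendsto_of_le_of_le' hl hlim2 ?_ ?_
  · filter_upwards [eventually_ge_atTop n₀] with N hN
    rw [one_div_mul_eq_div]
    exact div_le_div_of_nonneg_right (hlower N hN) N.cast_nonneg
  · filter_upwards [eventually_ge_atTop n₀] with N hN
    have hN' : (0 : ℝ) < N := by exact_mod_cast hpos N hN
    rw [one_div_mul_eq_div]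
    refine (div_le_div_of_nonneg_right (hupper N hN) hN'.le).trans_eq ?_
    have : ((N + n₀ : ℕ) : ℝ) ≠ 0 := by positivity
    push_cast at this ⊢
    field_simp

/-- The free energy vanishes as soon as the annealed partition function is bounded. -/
lemma tendsto_integral_log_zero (hK : K 0 = 0)
    {s c : ℝ} (hc : 0 < c) {n₀ : ℕ} (hn₀ : 0 < n₀)
    (hlow : ∀ n, n₀ ≤ n → c * (n : ℝ) ^ (-s) ≤ (K n).toReal) {C : ℝ}
    (hC : ∀ N, ∫ w, partitionFunction K β h w N ∂Q ≤ C) :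
    Tendsto (fun N : ℕ => 1 / (N : ℝ) * ∫ w, Real.log (partitionFunction K β h w N) ∂Q)
      atTop (𝓝 0) := by
  have hl1 : Tendsto (fun N : ℕ => Real.log c / N - s * (Real.log ((N + 1 : ℕ) : ℝ) / N))
      atTop (𝓝 (0 - s * 0)) :=
    (tendsto_const_nhds.div_atTop tendsto_natCast_atTop_atTop).sub
      ((tendsto_log_add_div 1).const_mul s)
  have hl2 : Tendsto (fun N : ℕ => C / N) atTop (𝓝 0) :=
    tendsto_const_nhds.div_atTop tendsto_natCast_atTop_atTop
  rw [mul_zero, sub_zero] at hl1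
  -- The trajectory whose first jump is N + 1 collects no reward or penalty.
  have hbound : ∀ N, n₀ ≤ N → ∀ w, c * ((N + 1 : ℕ) : ℝ) ^ (-s) ≤ partitionFunction K β h w N := by
    intro N hN w
    refine ((hlow (N + 1) (by omega)).trans ?_).trans (tail_le_partitionFunction hK w N)
    rw [Measure.real, ← K.toMeasure_apply_singleton _ (measurableSet_singleton (N + 1))]
    exact ENNReal.toReal_mono (measure_ne_top _ _) (measure_mono (by simp))
  have hKpos : ∀ n, n₀ ≤ n → 0 < (K n).toReal := fun n hn => by
    have : (0 : ℝ) < n := by exact_mod_cast hn₀.trans_le hn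
    exact lt_of_lt_of_le (by positivity) (hlow n hn)
  refine tendsto_of_tendsto_of_tendsto_of_le_of_le' hl1 hl2 ?_ ?_
  · filter_upwards [eventually_ge_atTop n₀] with N hN
    have hi := integrable_log_partitionFunction (β := β) (h := h) hbd hK (hn₀.trans_le hN)
      (hKpos N hN)
    have hx : (0 : ℝ) < ((N + 1 : ℕ) : ℝ) := by positivity
    have h1 : ∫ _, (Real.log c - s * Real.log ((N + 1 : ℕ) : ℝ)) ∂Q ≤
        ∫ w, Real.log (partitionFunction K β h w N) ∂Q := by
      refine integral_mono (integrable_const _) hi fun w => ?_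
      refine le_of_eq_of_le ?_ (Real.log_le_log (by positivity) (hbound N hN w))
      rw [Real.log_mul hc.ne' (by positivity), Real.log_rpow hx]
      ring
    simp only [integral_const, probReal_univ, smul_eq_mul, one_mul] at h1
    rw [one_div_mul_eq_div]
    refine le_of_eq_of_le ?_ (div_le_div_of_nonneg_right h1 N.cast_nonneg)
    ring
  · filter_upwards [eventually_ge_atTop n₀] with N hN
    have hi := integrable_log_partitionFunction (β := β) (h := h) hbd hK (hn₀.trans_le hN)
      (hKpos N hN)
    have hi2 : Integrable (fun w => partitionFunction K β h w N) Q := by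
      refine .of_mem_Icc 0 (Real.exp (B * N))
        (measurable_partitionFunction hK N).aemeasurable ?_
      filter_upwards [hbd] with w hw
      exact ⟨partitionFunction_nonneg w N, partitionFunction_le_exp hw N⟩
    -- The bound log x ≤ x suffices here in place of Jensen, because the annealed mean is bounded.
    have h1 : ∫ w, Real.log (partitionFunction K β h w N) ∂Q ≤
        ∫ w, partitionFunction K β h w N ∂Q :=
      integral_mono hi hi2 fun w => Real.log_le_self (partitionFunction_nonneg w N)
    rw [one_div_mul_eq_div]
    exact div_le_div_of_nonneg_right (h1.trans (hC N)) N.cast_nonneg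

end

/-! ### Localization under infinite disorder -/

lemma pinned_congr (N : ℕ) {w w' : ℕ → ℝ} (H : ∀ i ∈ Finset.Icc 1 N, w i = w' i) :
    pinned K β h N w = pinned K β h N w' := by
  induction N using Nat.strong_induction_on generalizing w w' with
  | _ N ih =>
    rcases Nat.eq_zero_or_pos N with rfl | hN
    · simp
    · rw [pinned_eq hN, pinned_eq hN]
      refine Finset.sum_congr rfl fun j hj => ?_
      rw [H j hj]
      rw [Finset.mem_Icc] at hj
      congr 1
      refine ih _ (by omega) fun i hi => H _ ?_
      rw [Finset.mem_Icc] at hi ⊢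
      omega

/-! ### The homogeneous model with every site attractive. -/

lemma hasSum_toReal (K : PMF ℕ) : HasSum (fun n => (K n).toReal) 1 := by
  have := ENNReal.hasSum_toReal (f := K) (by rw [K.tsum_coe]; simp)
  rwa [← ENNReal.tsum_toReal_eq K.apply_ne_top, K.tsum_coe] at this

lemma pinned_one_eq {N : ℕ} (hN : 0 < N) :
    pinned K β h N (fun _ => 1) = ∑ j ∈ Finset.Icc 1 N, (K j).toReal * Real.exp (h + β) *
      pinned K β h (N - j) (fun _ => 1) := by
  rw [pinned_eq hN]
  simp only [mul_one]
  rfl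

/-- Sum the renewal equation over n ≤ N + M and keep only first jumps j ≤ M; each then leaves room
for all remainders up to N. -/
lemma sum_pinned_one_ge (N M : ℕ) :
    (∑ j ∈ Finset.Icc 1 M, (K j).toReal * Real.exp (h + β)) *
      ∑ m ∈ Finset.range (N + 1), pinned K β h m (fun _ => 1) ≤
    ∑ m ∈ Finset.range (N + M + 1), pinned K β h m (fun _ => 1) := by
  set z : ℕ → ℝ := fun m => pinned K β h m (fun _ => 1) with hz
  have hz0 : ∀ m, 0 ≤ z m := fun m => pinned_nonneg m _
  have hk0 : ∀ j, 0 ≤ (K j).toReal * Real.exp (h + β) := fun j => by positivity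
  have h1 : ∑ n ∈ Finset.Icc 1 (N + M), z n =
      ∑ j ∈ Finset.Icc 1 (N + M), ∑ n ∈ Finset.Icc j (N + M),
        (K j).toReal * Real.exp (h + β) * z (n - j) := by
    rw [Finset.sum_comm' (t' := Finset.Icc 1 (N + M)) (s' := fun n => Finset.Icc 1 n)]
    · refine Finset.sum_congr rfl fun n hn => pinned_one_eq ?_
      exact (Finset.mem_Icc.1 hn).1
    · intro x y
      simp only [Finset.mem_Icc]
      omega
  have h2 : ∑ n ∈ Finset.Icc 1 (N + M), z n ≤ ∑ m ∈ Finset.range (N + M + 1), z m := by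
    refine Finset.sum_le_sum_of_subset_of_nonneg (fun x hx => ?_) fun j _ _ => hz0 j
    rw [Finset.mem_Icc] at hx
    rw [Finset.mem_range]
    omega
  refine le_trans ?_ (h1.symm.le.trans h2)
  rw [Finset.sum_mul]
  refine le_trans (Finset.sum_le_sum fun j hj => ?_)
    (Finset.sum_le_sum_of_subset_of_nonneg (Finset.Icc_subset_Icc_right (Nat.le_add_left M N))
      fun j _ _ => Finset.sum_nonneg fun n _ => mul_nonneg (hk0 j) (hz0 _))
  rw [Finset.mem_Icc] at hj
  rw [← Finset.mul_sum]
  refine mul_le_mul_of_nonneg_left ?_ (hk0 j)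
  have h3 : ∑ m ∈ Finset.range (N + 1), z m = ∑ n ∈ Finset.Ico j (j + (N + 1)), z (n - j) := by
    rw [Finset.sum_Ico_eq_sum_range]
    simp
  rw [h3]
  refine Finset.sum_le_sum_of_subset_of_nonneg (fun x hx => ?_) fun j _ _ => hz0 _
  rw [Finset.mem_Ico] at hx
  rw [Finset.mem_Icc]
  omega

/-- The homogeneous model with positive reward is localized. -/
lemma exists_one_lt_pinned_one (hK : K 0 = 0) (hpos : 0 < h + β) :
    ∃ m, 0 < m ∧ 1 < pinned K β h m (fun _ => 1) := by
  by_contra! hcon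
  have hle : ∀ m, pinned K β h m (fun _ => 1) ≤ 1 := fun m => by
    rcases Nat.eq_zero_or_pos m with rfl | hm
    · simp
    · exact hcon m hm
  -- The tilted kernel has total mass exp(h + β) > 1, so a finite truncation still exceeds 1.
  obtain ⟨M, hM⟩ : ∃ M, 1 < ∑ j ∈ Finset.Icc 1 M, (K j).toReal * Real.exp (h + β) := by
    have h1 := ((hasSum_toReal K).mul_right (Real.exp (h + β))).tendsto_sum_nat
    rw [one_mul] at h1
    obtain ⟨M, hM⟩ := (h1.eventually (lt_mem_nhds (Real.one_lt_exp_iff.2 hpos))).exists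
    refine ⟨M, hM.trans_le ?_⟩
    rw [← Finset.sum_subset (s₁ := (Finset.range M).erase 0) (Finset.erase_subset _ _)]
    · refine Finset.sum_le_sum_of_subset_of_nonneg (fun x hx => ?_) fun j _ _ => by positivity
      rw [Finset.mem_erase, Finset.mem_range] at hx
      rw [Finset.mem_Icc]
      omega
    · intro x _ hx'
      have : x = 0 := by
        by_contra hx0
        exact hx' (Finset.mem_erase.2 ⟨hx0, by assumption⟩)
      simp [this, hK]
  set ρ := ∑ j ∈ Finset.Icc 1 M, (K j).toReal * Real.exp (h + β) with hρ
  -- The partial sums grow exponentially in k, whereas terms bounded by 1 would allow only linear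
  -- growth.
  have hgrow : ∀ k : ℕ, ρ ^ k ≤ ∑ m ∈ Finset.range (k * M + 1), pinned K β h m (fun _ => 1) := by
    intro k
    induction k with
    | zero => simp
    | succ k ih =>
      rw [pow_succ', Nat.succ_mul]
      exact (mul_le_mul_of_nonneg_left ih (by linarith)).trans (sum_pinned_one_ge _ _)
  have hup : ∀ k : ℕ, ρ ^ k ≤ k * M + 1 := fun k => by
    refine (hgrow k).trans ((Finset.sum_le_card_nsmul _ _ 1 fun m _ => hle m).trans_eq ?_)
    simp
  have hlim : Tendsto (fun k : ℕ => M * ((k : ℝ) ^ 1 / ρ ^ k) + (k : ℝ) ^ 0 / ρ ^ k) atTop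
      (𝓝 (M * 0 + 0)) :=
    ((tendsto_pow_const_div_const_pow_of_one_lt 1 hM).const_mul _).add
      (tendsto_pow_const_div_const_pow_of_one_lt 0 hM)
  rw [mul_zero, add_zero] at hlim
  obtain ⟨k, hk⟩ := (hlim.eventually (gt_mem_nhds one_pos)).exists
  have hρk : 0 < ρ ^ k := pow_pos (by linarith) k
  have : M * ((k : ℝ) ^ 1 / ρ ^ k) + (k : ℝ) ^ 0 / ρ ^ k = (k * M + 1) / ρ ^ k := by
    ring
  rw [this, div_lt_one hρk] at hk
  exact absurd (hup k) (not_le.2 hk)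

/-- Environments that are attractive on `E`. -/
def plusSet (E : Finset ℕ) : Set (ℕ → ℝ) := {w | ∀ i ∈ E, w i = 1}

lemma measurableSet_plusSet (E : Finset ℕ) : MeasurableSet (plusSet E) := by
  have : plusSet E = ⋂ i ∈ E, (fun w : ℕ → ℝ => w i) ⁻¹' {1} := by
    ext; simp [plusSet]
  rw [this]
  exact .biInter E.countable_toSet fun i _ => measurable_pi_apply i (measurableSet_singleton 1)

lemma pow_le_pinned_mul (m k : ℕ) {w : ℕ → ℝ} (hw : ∀ i ∈ Finset.Icc 1 (m * k), w i = 1) :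
    pinned K β h m (fun _ => 1) ^ k ≤ pinned K β h (m * k) w := by
  rw [pinned_congr (m * k) (w' := fun _ => 1) hw]
  clear hw
  induction k with
  | zero => simp
  | succ k ih =>
    rw [pow_succ, Nat.mul_succ]
    exact (mul_le_mul_of_nonneg_right ih (pinned_nonneg _ _)).trans (pinned_mul_le (m * k) m _)

/-- Among the first `J` blocks of length `n`, the number of those on which `w` is attractive. -/
def goodBlocks (n J : ℕ) (w : ℕ → ℝ) : ℝ :=
  ∑ i ∈ Finset.range J, (plusSet (Finset.Icc 1 n)).indicator 1 (shiftBy (i * n) w)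

/-- Contribution of the trajectories that only visit attractive blocks. -/
lemma exists_goodBlocks_le_log_pinned (hpos : 0 < h + β)
    {s c : ℝ} (hs : 0 < s) (hc : 0 < c) {n₀ : ℕ} (hn₀ : 0 < n₀)
    (hlow : ∀ n, n₀ ≤ n → c * (n : ℝ) ^ (-s) ≤ (K n).toReal) {m k : ℕ}
    (hm : 1 < pinned K β h m (fun _ => 1)) {L : ℝ} (hL : 0 < L) (w : ℕ → ℝ) (J : ℕ) :
    ∃ t ≤ J * (n₀ + m * k), 0 < pinned K β h t w ∧
      goodBlocks (n₀ + m * k) J w *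
        (k * Real.log (pinned K β h m (fun _ => 1)) + Real.log c - s * Real.log L) - s / L * t ≤
      Real.log (pinned K β h t w) := by
  set n := n₀ + m * k with hn
  set b := pinned K β h m (fun _ => 1) with hb
  induction J with
  | zero => exact ⟨0, by simp, by simp, by simp [goodBlocks]⟩
  | succ J ih =>
    obtain ⟨t, ht, htpos, hlog⟩ := ih
    rw [goodBlocks, Finset.sum_range_succ, ← goodBlocks]
    by_cases hgood : shiftBy (J * n) w ∈ plusSet (Finset.Icc 1 n)
    · rw [Set.indicator_of_mem hgood, Pi.one_apply]
      -- Enter the good block at its site n₀: the jump then has length at least n₀ even if t is the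
      -- end of the previous block. The remaining m * k sites are used for k homogeneous stretches.
      set g := J * n + n₀ - t with hg
      have hgn : n₀ ≤ g := by omega
      have hgpos : (0 : ℝ) < g := by exact_mod_cast hn₀.trans_le hgn
      have hw1 : w (J * n + n₀) = 1 := by
        have := hgood n₀ (Finset.mem_Icc.2 ⟨hn₀, by omega⟩)
        rwa [shiftBy, add_comm] at this
      have hjump : c * (g : ℝ) ^ (-s) ≤ pinned K β h g (shiftBy t w) := by
        refine le_trans ?_ (weight_le_pinned (hn₀.trans_le hgn) _)
        have : shiftBy t w g = 1 := by rw [shiftBy, hg, Nat.sub_add_cancel (by omega), hw1]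
        rw [this, mul_one]
        exact (hlow g hgn).trans (le_mul_of_one_le_right ENNReal.toReal_nonneg
          (Real.one_le_exp hpos.le))
      have hstay : b ^ k ≤ pinned K β h (m * k) (shiftBy (t + g) w) := by
        refine pow_le_pinned_mul m k fun i hi => ?_
        rw [Finset.mem_Icc] at hi
        have := hgood (i + n₀) (Finset.mem_Icc.2 ⟨by omega, by omega⟩)
        rw [shiftBy] at this ⊢
        rw [← this]
        congr 1
        omega
      have hprod : pinned K β h t w * (c * (g : ℝ) ^ (-s)) * b ^ k ≤
          pinned K β h (t + g + m * k) w := by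
        refine le_trans ?_ (pinned_mul_le (t + g) (m * k) w)
        refine mul_le_mul ?_ hstay (by positivity) (pinned_nonneg _ _)
        exact (mul_le_mul_of_nonneg_left hjump htpos.le).trans (pinned_mul_le t g w)
      have hprodpos : 0 < pinned K β h t w * (c * (g : ℝ) ^ (-s)) * b ^ k := by positivity
      refine ⟨t + g + m * k, ?_, hprodpos.trans_le hprod, ?_⟩
      · rw [Nat.succ_mul]; omega
      · refine le_trans ?_ (Real.log_le_log hprodpos hprod)
        rw [Real.log_mul (by positivity) (by positivity), Real.log_mul htpos.ne' (by positivity),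
          Real.log_mul hc.ne' (by positivity), Real.log_rpow hgpos, Real.log_pow]
        -- Linearizing the logarithm at scale L makes the jump costs add up to at most (s/L) t plus
        -- a constant per good block, wherever the good blocks lie.
        have h1 : Real.log g ≤ Real.log L + g / L := by
          have := Real.log_le_self (div_nonneg hgpos.le hL.le)
          rw [Real.log_div hgpos.ne' hL.ne'] at this
          linarith
        have h2 : s * Real.log g ≤ s * Real.log L + s / L * g := by
          refine (mul_le_mul_of_nonneg_left h1 hs.le).trans_eq ?_
          ring
        have h3 : 0 ≤ s / L * ((m * k : ℕ) : ℝ) := by positivity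
        push_cast at h3 ⊢
        linarith
    · rw [Set.indicator_of_notMem hgood, add_zero]
      exact ⟨t, ht.trans (Nat.mul_le_mul_right n (Nat.le_succ J)), htpos, hlog⟩

section

variable {Q : Measure (ℕ → ℝ)} [IsProbabilityMeasure Q] {B : ℝ}

lemma integrable_indicator_plusSet (hQ : MeasurePreserving shift Q Q) (E : Finset ℕ) (j : ℕ) :
    Integrable (fun w => (plusSet E).indicator (1 : (ℕ → ℝ) → ℝ) (shiftBy j w)) Q :=
  (measurePreserving_shiftBy hQ j).integrable_comp_of_integrable
    ((integrable_const (1 : ℝ)).indicator (measurableSet_plusSet E))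

lemma integral_goodBlocks (hQ : MeasurePreserving shift Q Q) (n J : ℕ) :
    Integrable (goodBlocks n J) Q ∧
    ∫ w, goodBlocks n J w ∂Q = J * Q.real (plusSet (Finset.Icc 1 n)) := by
  refine ⟨integrable_finsetSum _ fun i _ => integrable_indicator_plusSet hQ _ _, ?_⟩
  unfold goodBlocks
  rw [integral_finsetSum _ fun i _ => integrable_indicator_plusSet hQ _ _]
  have : ∀ i ∈ Finset.range J, ∫ w, (plusSet (Finset.Icc 1 n)).indicator
      (1 : (ℕ → ℝ) → ℝ) (shiftBy (i * n) w) ∂Q = Q.real (plusSet (Finset.Icc 1 n)) := by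
    intro i _
    have hmp := measurePreserving_shiftBy hQ (i * n)
    have h1 := integral_map (μ := Q)
      (f := (plusSet (Finset.Icc 1 n)).indicator (1 : (ℕ → ℝ) → ℝ)) hmp.measurable.aemeasurable
      (measurable_one.indicator (measurableSet_plusSet _)).aestronglyMeasurable
    rw [← h1, hmp.map_eq, integral_indicator_one (measurableSet_plusSet _)]
  rw [Finset.sum_congr rfl this]
  simp

/-- Averaging the pathwise bound, stationarity gives J p expected good blocks among J. Divide by J
and let J tend to infinity. -/
lemma le_freeEnergy_of_blocks (hbd : ∀ᵐ w ∂Q, ∀ n, |h + β * w n| ≤ B)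
    (hQ : MeasurePreserving shift Q Q) (hK : K 0 = 0) (hpos : 0 < h + β)
    {s c : ℝ} (hs : 0 < s) (hc : 0 < c) {n₀ : ℕ} (hn₀ : 0 < n₀)
    (hlow : ∀ n, n₀ ≤ n → c * (n : ℝ) ^ (-s) ≤ (K n).toReal) {m k : ℕ}
    (hm : 1 < pinned K β h m (fun _ => 1)) {L : ℝ} (hL : 0 < L) {l : ℝ}
    (hl : ∀ N : ℕ, n₀ ≤ N → (∫ w, Real.log (pinned K β h N w) ∂Q) / N ≤ l) :
    Q.real (plusSet (Finset.Icc 1 (n₀ + m * k))) *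
      (k * Real.log (pinned K β h m (fun _ => 1)) + Real.log c - s * Real.log L) -
      s / L * (n₀ + m * k : ℕ) ≤ l * (n₀ + m * k : ℕ) := by
  set n := n₀ + m * k with hn
  set A := k * Real.log (pinned K β h m (fun _ => 1)) + Real.log c - s * Real.log L with hA
  set p := Q.real (plusSet (Finset.Icc 1 n)) with hp
  have hnpos : 0 < n := by omega
  have hKpos : ∀ n, n₀ ≤ n → 0 < (K n).toReal := fun n hn => by
    have : (0 : ℝ) < n := by exact_mod_cast hn₀.trans_le hn
    exact lt_of_lt_of_le (by positivity) (hlow n hn)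
  have key : ∀ J : ℕ, J * (p * A) + (Real.log c - s * Real.log ((J * n + n₀ : ℕ) : ℝ) - B -
      s / L * (J * n : ℕ)) ≤ l * (J * n + n₀ : ℕ) := by
    intro J
    have hN : (0 : ℝ) < ((J * n + n₀ : ℕ) : ℝ) := by exact_mod_cast Nat.add_pos_right _ hn₀
    have h1 := hl (J * n + n₀) (Nat.le_add_left _ _)
    rw [div_le_iff₀ hN] at h1
    refine le_trans ?_ h1
    obtain ⟨hGi, hGe⟩ := integral_goodBlocks hQ n J
    have h2 : ∫ w, (goodBlocks n J w * A + (Real.log c - s * Real.log ((J * n + n₀ : ℕ) : ℝ) - B -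
      s / L * (J * n : ℕ))) ∂Q ≤ ∫ w, Real.log (pinned K β h (J * n + n₀) w) ∂Q := by
      refine integral_mono_ae ((hGi.mul_const A).add (integrable_const _))
        (integrable_log_pinned hbd hK (by omega) (hKpos _ (by omega))) ?_
      filter_upwards [hbd] with w hw
      obtain ⟨t, ht, htpos, hlog⟩ :=
        exists_goodBlocks_le_log_pinned hpos hs hc hn₀ hlow (k := k) hm hL w J
      rw [← hn] at ht hlog
      set g := J * n + n₀ - t with hg
      have hgn : n₀ ≤ g := by omega
      have hgpos : (0 : ℝ) < g := by exact_mod_cast hn₀.trans_le hgn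
      -- One closing jump to the deterministic endpoint; its logarithmic cost disappears in the
      -- limit in J.
      have hjump : c * ((J * n + n₀ : ℕ) : ℝ) ^ (-s) * Real.exp (-B) ≤
          pinned K β h g (shiftBy t w) := by
        refine le_trans ?_ (weight_le_pinned (hn₀.trans_le hgn) _)
        refine mul_le_mul ?_ (Real.exp_le_exp.2 (abs_le.1 (hw _)).1) (Real.exp_pos _).le
          ENNReal.toReal_nonneg
        refine le_trans (mul_le_mul_of_nonneg_left ?_ hc.le) (hlow g hgn)
        exact Real.rpow_le_rpow_of_nonpos hgpos (by exact_mod_cast Nat.sub_le _ _) (by linarith)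
      have hprod := (mul_le_mul_of_nonneg_left hjump htpos.le).trans (pinned_mul_le t g w)
      rw [show t + g = J * n + n₀ by omega] at hprod
      refine le_trans ?_ (Real.log_le_log (by positivity) hprod)
      rw [Real.log_mul htpos.ne' (by positivity), Real.log_mul (by positivity) (Real.exp_pos _).ne',
          Real.log_mul hc.ne' (by positivity), Real.log_rpow hN, Real.log_exp]
      have h3 : s / L * t ≤ s / L * (J * n : ℕ) :=
        mul_le_mul_of_nonneg_left (by exact_mod_cast ht) (by positivity)
      linarith
    rw [integral_add (hGi.mul_const A) (integrable_const _), integral_mul_const, hGe] at h2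
    simp only [integral_const, probReal_univ, smul_eq_mul, one_mul] at h2
    rwa [mul_assoc] at h2
  have hJn : Tendsto (fun J : ℕ => J * n) atTop atTop :=
    tendsto_id.atTop_mul_const' hnpos
  have hlim : Tendsto (fun J : ℕ => p * A - s / L * n + ((Real.log c - B) / J -
      s * (n * (Real.log ((J * n + n₀ : ℕ) : ℝ) / (J * n : ℕ))))) atTop
      (𝓝 (p * A - s / L * n + (0 - s * (n * 0)))) := by
    have e1 : Tendsto (fun J : ℕ => (Real.log c - B) / J) atTop (𝓝 0) :=
      tendsto_const_nhds.div_atTop tendsto_natCast_atTop_atTop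
    exact tendsto_const_nhds.add (e1.sub
      ((((tendsto_log_add_div n₀).comp hJn).const_mul _).const_mul s))
  have hlim2 : Tendsto (fun J : ℕ => l * n + l * n₀ / J) atTop (𝓝 (l * n + 0)) :=
    tendsto_const_nhds.add (tendsto_const_nhds.div_atTop tendsto_natCast_atTop_atTop)
  rw [add_zero] at hlim2
  simp only [mul_zero, sub_zero, add_zero] at hlim
  refine le_of_tendsto_of_tendsto hlim hlim2 ?_
  filter_upwards [eventually_gt_atTop 0] with J hJ
  have hJ' : (0 : ℝ) < J := by exact_mod_cast hJ
  have hn' : (n : ℝ) ≠ 0 := by exact_mod_cast hnpos.ne'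
  have := div_le_div_of_nonneg_right (key J) hJ'.le
  refine le_of_eq_of_le ?_ (this.trans_eq ?_)
  · rw [Nat.cast_mul]
    generalize Real.log ((J * n + n₀ : ℕ) : ℝ) = y
    field_simp
    ring
  · push_cast
    field_simp

lemma freeEnergy_pos_of_frequently (hbd : ∀ᵐ w ∂Q, ∀ n, |h + β * w n| ≤ B)
    (hQ : MeasurePreserving shift Q Q) (hK : K 0 = 0) (hpos : 0 < h + β)
    {s c : ℝ} (hs : 0 < s) (hc : 0 < c) {n₀ : ℕ} (hn₀ : 0 < n₀)
    (hlow : ∀ n, n₀ ≤ n → c * (n : ℝ) ^ (-s) ≤ (K n).toReal) {l : ℝ}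
    (hl : ∀ N : ℕ, n₀ ≤ N → (∫ w, Real.log (pinned K β h N w) ∂Q) / N ≤ l)
    (hdis : ∀ η : ℝ, 0 < η →
      ∃ᶠ n : ℕ in atTop, Real.exp (-(η * n)) ≤ Q.real (plusSet (Finset.Icc 1 n))) :
    0 < l := by
  obtain ⟨m, hm0, hm⟩ := exists_one_lt_pinned_one (K := K) hK hpos
  set b := pinned K β h m (fun _ => 1) with hb
  have hm' : (0 : ℝ) < m := by exact_mod_cast hm0
  have hlogb : 0 < Real.log b := Real.log_pos hm
  -- With n ≈ mk, the costs -s log p and sηn total about 2sηmk = (k log b)/2, half of the gain k log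
  -- b.
  set η := Real.log b / (4 * s * m) with hη
  have hηpos : 0 < η := by positivity
  have hηe : s * η * m = Real.log b / 4 := by rw [hη]; field_simp
  have hlin : Tendsto (fun k : ℕ => (k : ℝ) * (Real.log b / 2) +
      (Real.log c + s * Real.log η - 2 * s * η * n₀ - s * η * m)) atTop atTop :=
    tendsto_atTop_add_const_right _ _
      (tendsto_natCast_atTop_atTop.atTop_mul_const (half_pos hlogb))
  obtain ⟨k₀, hk₀⟩ := eventually_atTop.1 (hlin.eventually (eventually_gt_atTop 0))
  obtain ⟨N, hN, hpN⟩ := (frequently_atTop.1 (hdis η hηpos)) (n₀ + m * k₀)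
  -- The disorder hypothesis supplies an arbitrary length N; round down to the form n₀ + m * k,
  -- losing less than m sites and only increasing the probability.
  set k := (N - n₀) / m with hk
  have hmod := Nat.div_add_mod (N - n₀) m
  have hlt := Nat.mod_lt (N - n₀) hm0
  rw [← hk] at hmod
  have hkk : k₀ ≤ k := by
    rw [hk, Nat.le_div_iff_mul_le hm0, mul_comm]; omega
  set n := n₀ + m * k with hn
  have hnN : n ≤ N := by omega
  have hNn : N ≤ n + m := by omega
  set p := Q.real (plusSet (Finset.Icc 1 n)) with hp
  have hple : Real.exp (-(η * (n + m))) ≤ p := by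
    refine le_trans (Real.exp_le_exp.2 ?_) (hpN.trans (measureReal_mono ?_))
    · have : (N : ℝ) ≤ n + m := by exact_mod_cast hNn
      nlinarith
    · intro w hw i hi
      exact hw i (Finset.Icc_subset_Icc_right hnN hi)
  have hp0 : 0 < p := (Real.exp_pos _).trans_le hple
  have hlogp : -(η * (n + m)) ≤ Real.log p := (Real.le_log_iff_exp_le hp0).2 hple
  -- The scale L = 1/(ηp) makes the linear cost sn/L equal to sηpn, proportional to p like the gain,
  -- so p factors out.
  have hL : 0 < 1 / (η * p) := by positivity
  have key := le_freeEnergy_of_blocks (k := k) hbd hQ hK hpos hs hc hn₀ hlow hm hL hl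
  rw [← hn, ← hp, ← hb, one_div, Real.log_inv, Real.log_mul hηpos.ne' hp0.ne', div_inv_eq_mul]
    at key
  have hn' : (0 : ℝ) < n := by exact_mod_cast (show 0 < n by omega)
  refine pos_of_mul_pos_left ?_ hn'.le
  refine lt_of_lt_of_le ?_ key
  have hbr : 0 < k * Real.log b + Real.log c + s * Real.log η + s * Real.log p - s * η * n := by
    have h1 := hk₀ k hkk
    have h2 : s * -(η * (n + m)) ≤ s * Real.log p := mul_le_mul_of_nonneg_left hlogp hs.le
    have h3 : (n : ℝ) = n₀ + m * k := by rw [hn]; push_cast; ring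
    have h4 : s * η * m * k = Real.log b / 4 * k := by rw [hηe]
    rw [h3] at h2 ⊢
    linarith
  have := mul_pos hp0 hbr
  linarith

end

/-! ### Annealed bound in the absence of infinite disorder -/

lemma translate_zero (E : Finset ℕ) : translate 0 E = E := by simp [translate]

lemma shiftBy_preimage_plusSet (j : ℕ) (E : Finset ℕ) :
    shiftBy j ⁻¹' plusSet E = plusSet (translate j E) := by
  ext w; simp [plusSet, translate, shiftBy]

section

variable {Q : Measure (ℕ → ℝ)} {B : ℝ}

lemma measure_plusSet_translate (hQ : MeasurePreserving shift Q Q) (j : ℕ) (E : Finset ℕ) :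
    Q (plusSet (translate j E)) = Q (plusSet E) := by
  rw [← shiftBy_preimage_plusSet, (measurePreserving_shiftBy hQ j).measure_preimage
    (measurableSet_plusSet E).nullMeasurableSet]

/-- Under non-increasing correlations, compressing the right part of a configuration of attractive
sites into an interval increases its probability. -/
lemma measure_plusSet_union_le
    (hcorr : ∀ E₁ E₂ : Finset ℕ, E₁.Nonempty → E₂.Nonempty → (∀ i ∈ E₁, ∀ j ∈ E₂, i < j) →
      ∀ k : ℕ, Q (plusSet (E₁ ∪ translate (k + 1) E₂)) ≤ Q (plusSet (E₁ ∪ translate k E₂)))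
    (m : ℕ) {A E : Finset ℕ} {s : ℕ} (hE : E.card = m) (hA : A.Nonempty) (hAs : ∀ a ∈ A, a < s)
    (hEs : ∀ e ∈ E, s ≤ e) :
    Q (plusSet (A ∪ E)) ≤ Q (plusSet (A ∪ Finset.Ico s (s + m))) := by
  induction m generalizing A E s with
  | zero => rw [Finset.card_eq_zero] at hE; simp [hE]
  | succ m ih =>
    have hne : E.Nonempty := Finset.card_pos.1 (by omega)
    set i := E.min' hne with hi
    have hiE : i ∈ E := E.min'_mem hne
    have hmin : ∀ e ∈ E, i ≤ e := fun e he => E.min'_le e he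
    have hsi : s ≤ i := hEs i hiE
    -- Slide E left until its minimum sits at s, which can only increase the probability; s then
    -- joins the left part and the remaining points are compressed by induction.
    set E₀ : Finset ℕ := E.image (fun e => e - (i - s)) with hE₀
    have hEt : translate (i - s) E₀ = E := by
      rw [translate, hE₀, Finset.image_image]
      conv_rhs => rw [← Finset.image_id (s := E)]
      refine Finset.image_congr fun e he => ?_
      have := hmin e he
      simp only [Function.comp_apply, id]
      omega
    have hcard : E₀.card = m + 1 := by
      rw [← hE, ← hEt, translate, Finset.card_image_of_injective _ (add_left_injective _)]
    have hsE₀ : s ∈ E₀ := Finset.mem_image.2 ⟨i, hiE, by omega⟩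
    have hE₀s : ∀ e ∈ E₀, s ≤ e := by
      intro e he
      obtain ⟨e', he', rfl⟩ := Finset.mem_image.1 he
      have := hmin e' he'
      omega
    have hanti : Antitone fun k => Q (plusSet (A ∪ translate k E₀)) :=
      antitone_nat_of_succ_le (hcorr A E₀ hA ⟨s, hsE₀⟩
        fun a ha e he => (hAs a ha).trans_le (hE₀s e he))
    have h1 := hanti (Nat.zero_le (i - s))
    simp only [translate_zero, hEt] at h1
    refine h1.trans ?_
    have hsplit : A ∪ E₀ = insert s A ∪ E₀.erase s := by
      rw [Finset.insert_union, ← Finset.union_insert, Finset.insert_erase hsE₀]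
    rw [hsplit]
    refine (ih (s := s + 1) (by rw [Finset.card_erase_of_mem hsE₀, hcard]; rfl)
      (Finset.insert_nonempty _ _) ?_ ?_).trans_eq ?_
    · intro a ha
      rcases Finset.mem_insert.1 ha with rfl | ha
      · omega
      · exact (hAs a ha).trans (Nat.lt_succ_self s)
    · intro e he
      rw [Finset.mem_erase] at he
      have := hE₀s e he.2
      omega
    · congr 2
      ext x
      simp only [Finset.mem_union, Finset.mem_insert, Finset.mem_Ico]
      by_cases hx : x ∈ A
      · simp only [hx, true_or, or_true]
      · simp only [hx, or_false, false_or]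
        omega

/-- The minimum of E serves as the nonempty left part required by the correlation hypothesis. Once
the rest is packed against it, stationarity moves the interval to start at 1. -/
lemma measure_plusSet_le
    (hcorr : ∀ E₁ E₂ : Finset ℕ, E₁.Nonempty → E₂.Nonempty → (∀ i ∈ E₁, ∀ j ∈ E₂, i < j) →
      ∀ k : ℕ, Q (plusSet (E₁ ∪ translate (k + 1) E₂)) ≤ Q (plusSet (E₁ ∪ translate k E₂)))
    (hQ : MeasurePreserving shift Q Q) (E : Finset ℕ) :
    Q (plusSet E) ≤ Q (plusSet (Finset.Icc 1 E.card)) := by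
  rcases E.eq_empty_or_nonempty with rfl | hne
  · simp
  set i := E.min' hne with hi
  have hiE : i ∈ E := E.min'_mem hne
  have h1 := measure_plusSet_union_le hcorr (E.card - 1) (A := {i}) (E := E.erase i) (s := i + 1)
    (Finset.card_erase_of_mem hiE) (Finset.singleton_nonempty i) (by simp) (fun e he => by
      rw [Finset.mem_erase] at he
      have := E.min'_le e he.2
      omega)
  have hc : 0 < E.card := hne.card_pos
  rw [Finset.singleton_union, Finset.insert_erase hiE] at h1
  refine h1.trans_eq ?_
  have e1 : {i} ∪ Finset.Ico (i + 1) (i + 1 + (E.card - 1)) =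
      translate i (Finset.Ico 0 E.card) := by
    rw [translate, Finset.image_add_right_Ico]
    ext x
    simp only [Finset.mem_union, Finset.mem_singleton, Finset.mem_Ico]
    omega
  have e2 : Finset.Icc 1 E.card = translate 1 (Finset.Ico 0 E.card) := by
    rw [translate, Finset.image_add_right_Ico]
    ext x
    simp only [Finset.mem_Icc, Finset.mem_Ico]
    omega
  rw [e1, e2, measure_plusSet_translate hQ, measure_plusSet_translate hQ]

/-! ### Boundedness of the annealed partition function. -/

variable [IsProbabilityMeasure Q]

/-- Each factor is at most exp(ε) times (1 - q) 1_{plus} + q. Expanding over the subsets S of E that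
are required to be attractive and using the bound C r^|S|, the sum reassembles by the binomial
formula as if the sites were independent with density r. -/
lemma integral_prod_exp_le {C r q ε : ℝ} (hr : 0 ≤ r) (hβ : 0 < β)
    (hq : q = Real.exp (-(2 * β))) (hε : Real.exp ε * ((1 - q) * r + q) ≤ 1)
    (hh : h + β ≤ ε) (hC : 0 ≤ C)
    (hval : ∀ᵐ w ∂Q, ∀ n, w n = 1 ∨ w n = -1)
    (hE : ∀ E : Finset ℕ, Q.real (plusSet E) ≤ C * r ^ E.card) (E : Finset ℕ) :
    ∫ w, ∏ i ∈ E, Real.exp (h + β * w i) ∂Q ≤ C := by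
  classical
  have hq0 : 0 < q := hq ▸ Real.exp_pos _
  have hq1 : q < 1 := by rw [hq]; exact Real.exp_lt_one_iff.2 (by linarith)
  set u : Finset ℕ → (ℕ → ℝ) → ℝ := fun S w =>
    (Real.exp ε) ^ E.card * ((1 - q) ^ S.card * q ^ (E \ S).card) *
      (plusSet S).indicator (1 : (ℕ → ℝ) → ℝ) w with hu
  have hui : ∀ S, Integrable (u S) Q := fun S =>
    ((integrable_const (1 : ℝ)).indicator (measurableSet_plusSet S)).const_mul _
  have h1 : ∫ w, ∏ i ∈ E, Real.exp (h + β * w i) ∂Q ≤ ∫ w, ∑ S ∈ E.powerset, u S w ∂Q := by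
    refine integral_mono_of_nonneg (ae_of_all _ fun w => by positivity)
      (integrable_finsetSum _ fun S _ => hui S) ?_
    filter_upwards [hval] with w hw
    have hfac : ∀ i ∈ E, Real.exp (h + β * w i) ≤
        Real.exp ε * ((1 - q) * (if w i = 1 then 1 else 0) + q) := by
      intro i _
      rcases hw i with hi | hi
      · rw [if_pos hi, hi]
        simpa using hh
      · rw [if_neg (by rw [hi]; norm_num), hi, hq, mul_zero, zero_add, ← Real.exp_add]
        exact Real.exp_le_exp.2 (by linarith)
    refine (Finset.prod_le_prod (fun i _ => (Real.exp_pos _).le) hfac).trans_eq ?_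
    rw [Finset.prod_mul_distrib, Finset.prod_const, Finset.prod_add, Finset.mul_sum]
    refine Finset.sum_congr rfl fun S _ => ?_
    rw [Finset.prod_mul_distrib, Finset.prod_const, Finset.prod_const, Finset.prod_boole]
    simp only [hu, Set.indicator_apply, plusSet, Set.mem_ofPred_eq, Pi.one_apply]
    ring
  refine h1.trans ?_
  rw [integral_finsetSum _ fun S _ => hui S]
  have h2 : ∀ S ∈ E.powerset, ∫ w, u S w ∂Q ≤
      (Real.exp ε) ^ E.card * C * (((1 - q) * r) ^ S.card * q ^ (E \ S).card) := by
    intro S _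
    rw [hu]
    simp only
    rw [integral_const_mul, integral_indicator_one (measurableSet_plusSet S)]
    have h1q : 0 < 1 - q := by linarith
    refine (mul_le_mul_of_nonneg_left (hE S) (by positivity)).trans_eq ?_
    rw [mul_pow]
    ring
  refine (Finset.sum_le_sum h2).trans ?_
  rw [← Finset.mul_sum]
  have h3 : ∑ S ∈ E.powerset, ((1 - q) * r) ^ S.card * q ^ (E \ S).card =
      ((1 - q) * r + q) ^ E.card := by
    have := Finset.prod_add (fun _ : ℕ => (1 - q) * r) (fun _ => q) E
    simpa only [Finset.prod_const] using this.symm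
  rw [h3, mul_right_comm, ← mul_pow]
  have h1q : 0 < 1 - q := by linarith
  exact mul_le_of_le_one_left hC (pow_le_one₀ (by positivity) hε)

open Classical in
lemma exp_energy_eq (w : ℕ → ℝ) (N : ℕ) (ξ : ℕ → ℕ) : Real.exp (energy β h w N ξ) =
    ∏ i ∈ (Finset.Icc 1 N).filter (fun n => n ∈ Set.range (renewalTime ξ)),
      Real.exp (h + β * w i) := by
  rw [energy, ← Real.exp_sum, Finset.sum_filter]
  congr 1
  refine Finset.sum_congr rfl fun n _ => ?_
  rw [contact, mul_ite, mul_one, mul_zero]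

/-- By Fubini, average over the environment first: for a fixed trajectory the weight is a product
over its contact set. -/
lemma integral_partitionFunction_le (hbd : ∀ᵐ w ∂Q, ∀ n, |h + β * w n| ≤ B) {C : ℝ}
    (hE : ∀ E : Finset ℕ, ∫ w, ∏ i ∈ E, Real.exp (h + β * w i) ∂Q ≤ C) (N : ℕ) :
    ∫ w, partitionFunction K β h w N ∂Q ≤ C := by
  have hmeas : Measurable (fun p : (ℕ → ℝ) × (ℕ → ℕ) => energy β h p.1 N p.2) := by
    refine Finset.measurable_sum _ fun n _ => Measurable.mul ?_ ?_
    · fun_prop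
    · exact (measurable_contact n).comp measurable_snd
  have hint : Integrable (fun p : (ℕ → ℝ) × (ℕ → ℕ) => Real.exp (energy β h p.1 N p.2))
      (Q.prod (renewalLaw K)) := by
    refine .of_mem_Icc 0 (Real.exp (∑ n ∈ Finset.Icc 1 N, B)) hmeas.exp.aemeasurable ?_
    filter_upwards [Measure.quasiMeasurePreserving_fst.ae hbd] with p hp
    refine ⟨(Real.exp_pos _).le, Real.exp_le_exp.2 ?_⟩
    exact (le_abs_self _).trans ((abs_energy_le β h p.1 N p.2).trans
      (Finset.sum_le_sum fun n _ => hp n))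
  have hswap : ∫ w, partitionFunction K β h w N ∂Q =
      ∫ ξ, ∫ w, Real.exp (energy β h w N ξ) ∂Q ∂(renewalLaw K) :=
    integral_integral_swap hint
  rw [hswap]
  have : ∫ ξ, ∫ w, Real.exp (energy β h w N ξ) ∂Q ∂(renewalLaw K) ≤
      ∫ _, C ∂(renewalLaw K) := by
    refine integral_mono hint.integral_prod_right (integrable_const _) fun ξ => ?_
    simp_rw [exp_energy_eq]
    exact hE _
  simpa using this

end

/-! ### The infinite disorder condition -/

lemma neg_log_lt_iff {n : ℕ} (hn : 0 < n) {p : ENNReal} (hp : p ≠ ⊤) (x : ℝ) :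
    -(((1 / (n : ℝ) : ℝ) : EReal) * ENNReal.log p) < (x : EReal) ↔
      Real.exp (-(x * n)) < p.toReal := by
  have hn' : (0 : ℝ) < n := by exact_mod_cast hn
  rcases eq_or_ne p 0 with rfl | hp0
  · rw [ENNReal.log_zero, EReal.coe_mul_bot_of_pos (by positivity)]
    simp [(Real.exp_pos _).le]
  · have hpos : 0 < p.toReal := ENNReal.toReal_pos hp0 hp
    rw [ENNReal.log_pos_real hp0 hp, ← EReal.coe_mul, ← EReal.coe_neg, EReal.coe_lt_coe_iff,
      ← Real.lt_log_iff_exp_lt hpos, neg_lt, one_div, inv_mul_eq_div, lt_div_iff₀ hn']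
    rw [neg_mul]

section

variable {Ω : Type*} [MeasurableSpace Ω] {P : Measure Ω} [IsProbabilityMeasure P]
  {ω : ℕ → Ω → ℝ}

lemma InfiniteDisorder.frequently (hdis : InfiniteDisorder P ω) {η : ℝ} (hη : 0 < η) :
    ∃ᶠ n : ℕ in atTop, Real.exp (-(η * n)) ≤ P.real (allPlus ω (Finset.Icc 1 n)) := by
  have h1 := frequently_lt_of_liminf_lt (h := lt_of_eq_of_lt hdis (EReal.coe_pos.2 hη))
  refine (h1.and_eventually (eventually_gt_atTop 0)).mono fun n ⟨hn, hn0⟩ => ?_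
  exact ((neg_log_lt_iff hn0 (measure_ne_top _ _) η).1 hn).le

lemma exists_le_of_not_infiniteDisorder (hdis : ¬ InfiniteDisorder P ω) :
    ∃ C r : ℝ, 0 < C ∧ 0 < r ∧ r < 1 ∧
      ∀ n : ℕ, P.real (allPlus ω (Finset.Icc 1 n)) ≤ C * r ^ n := by
  have hnn : 0 ≤ liminf (fun n : ℕ =>
      -(((1 / (n : ℝ) : ℝ) : EReal) * ENNReal.log (P (allPlus ω (Finset.Icc 1 n))))) atTop := by
    refine le_liminf_of_le (by isBoundedDefault) ?_
    filter_upwards [eventually_gt_atTop 0] with n hn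
    rw [← not_lt, ← EReal.coe_zero, neg_log_lt_iff hn (measure_ne_top _ _)]
    simpa [Measure.real] using measureReal_le_one (μ := P) (s := allPlus ω (Finset.Icc 1 n))
  -- The liminf is always nonnegative, so a nonzero value is a strictly positive exponential rate.
  have hpos := lt_of_le_of_ne hnn (Ne.symm hdis)
  obtain ⟨c, hc0, hc⟩ := EReal.lt_iff_exists_real_btwn.1 hpos
  rw [EReal.coe_pos] at hc0
  obtain ⟨n₁, hn₁⟩ := eventually_atTop.1 (eventually_lt_of_lt_liminf hc)
  -- The prefactor makes the bound trivial for n ≤ n₁, and in particular for n = 0.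
  refine ⟨Real.exp (c * (n₁ + 1)), Real.exp (-c), Real.exp_pos _, Real.exp_pos _,
    Real.exp_lt_one_iff.2 (by linarith), fun n => ?_⟩
  rw [← Real.exp_nat_mul, ← Real.exp_add]
  rcases lt_or_ge n (n₁ + 1) with hn | hn
  · have : (n : ℝ) ≤ n₁ + 1 := by exact_mod_cast hn.le
    exact measureReal_le_one.trans (Real.one_le_exp (by nlinarith))
  · have h1 := (hn₁ n (by omega)).le
    rw [← not_lt, neg_log_lt_iff (by omega) (measure_ne_top _ _), not_lt] at h1
    refine h1.trans (Real.exp_le_exp.2 ?_)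
    have : 0 ≤ c * (n₁ + 1) := by positivity
    linarith

/-! ### The law of the environment -/

variable (hω : IsEnvironment P ω)
include hω

omit [IsProbabilityMeasure P] in
lemma IsEnvironment.measurable_path : Measurable (fun a i => ω i a) :=
  measurable_pi_iff.2 hω.measurable

omit [IsProbabilityMeasure P] in
lemma IsEnvironment.map_plusSet (E : Finset ℕ) :
    P.map (fun a i => ω i a) (plusSet E) = P (allPlus ω E) := by
  rw [Measure.map_apply hω.measurable_path (measurableSet_plusSet E)]
  rfl

omit [IsProbabilityMeasure P] in
lemma IsEnvironment.ae_values :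
    ∀ᵐ w ∂(P.map (fun a i => ω i a)), ∀ n, w n = 1 ∨ w n = -1 := by
  rw [ae_all_iff]
  intro n
  have hs : MeasurableSet {w : ℕ → ℝ | w n = 1 ∨ w n = -1} :=
    (measurable_pi_apply n (measurableSet_singleton 1)).union
      (measurable_pi_apply n (measurableSet_singleton (-1)))
  rw [ae_map_iff hω.measurable_path.aemeasurable hs]
  exact hω.values n

omit [IsProbabilityMeasure P] in
lemma IsEnvironment.ae_abs_le (β h : ℝ) :
    ∀ᵐ w ∂(P.map (fun a i => ω i a)), ∀ n, |h + β * w n| ≤ |h| + |β| := by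
  filter_upwards [hω.ae_values] with w hw n
  refine (abs_add_le _ _).trans_eq ?_
  rw [abs_mul]
  rcases hw n with hn | hn <;> simp [hn]

omit [IsProbabilityMeasure P] in
lemma freeEnergy_eq_of_tendsto (hK : K 0 = 0) {l : ℝ}
    (hl : Tendsto (fun N : ℕ => 1 / (N : ℝ) *
      ∫ w, Real.log (partitionFunction K β h w N) ∂(P.map (fun a i => ω i a))) atTop (𝓝 l)) :
    freeEnergy K P ω β h = l := by
  refine Tendsto.limUnder_eq (hl.congr fun N => ?_)
  rw [integral_map hω.measurable_path.aemeasurable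
    (measurable_partitionFunction hK N).log.aestronglyMeasurable]

/-! ### Sign of the free energy and location of the critical point. -/

lemma freeEnergy_pos (hK : IsInterArrival K) (hdis : InfiniteDisorder P ω) (hpos : 0 < h + β) :
    0 < freeEnergy K P ω β h := by
  have : IsProbabilityMeasure (P.map (fun a i => ω i a)) :=
    Measure.isProbabilityMeasure_map hω.measurable_path.aemeasurable
  obtain ⟨s, c, hs, hc, n₀, hn₀, hlow⟩ := hK.exists_lower_bound
  have hQ := hω.ergodic.toMeasurePreserving
  have hbd := hω.ae_abs_le β h
  obtain ⟨l, hl, hle⟩ := exists_tendsto_integral_log hbd hQ hK.zero hs hc hn₀ hlow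
  rw [freeEnergy_eq_of_tendsto hω hK.zero hl]
  refine freeEnergy_pos_of_frequently hbd hQ hK.zero hpos hs hc hn₀ hlow hle fun η hη => ?_
  simp only [Measure.real, hω.map_plusSet]
  exact hdis.frequently hη

lemma freeEnergy_eq_zero_of_le (hK : IsInterArrival K) (hβ : 0 < β) (hh : h ≤ -β) :
    freeEnergy K P ω β h = 0 := by
  have : IsProbabilityMeasure (P.map (fun a i => ω i a)) :=
    Measure.isProbabilityMeasure_map hω.measurable_path.aemeasurable
  obtain ⟨s, c, hs, hc, n₀, hn₀, hlow⟩ := hK.exists_lower_bound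
  have hbd := hω.ae_abs_le β h
  refine freeEnergy_eq_of_tendsto hω hK.zero
    (tendsto_integral_log_zero hbd hK.zero hc hn₀ hlow (C := 1) fun N => ?_)
  have h1 : ∫ w, partitionFunction K β h w N ∂(P.map (fun a i => ω i a)) ≤
      ∫ _, (1 : ℝ) ∂(P.map (fun a i => ω i a)) := by
    refine integral_mono_of_nonneg (ae_of_all _ fun w => partitionFunction_nonneg w N)
      (integrable_const _) ?_
    filter_upwards [hω.ae_values] with w hw
    refine partitionFunction_le_one (fun n => ?_) N
    rcases hw n with hn | hn <;> rw [hn] <;> linarith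
  simpa using h1

/-- Without infinite disorder the model is delocalized in a right neighbourhood of `-β`. -/
lemma exists_freeEnergy_eq_zero (hcorr : NonIncreasingCorrelations P ω) (hK : IsInterArrival K)
    (hdis : ¬ InfiniteDisorder P ω) (hβ : 0 < β) :
    ∃ ε > 0, ∀ h ≤ -β + ε, freeEnergy K P ω β h = 0 := by
  have : IsProbabilityMeasure (P.map (fun a i => ω i a)) :=
    Measure.isProbabilityMeasure_map hω.measurable_path.aemeasurable
  obtain ⟨s, c, hs, hc, n₀, hn₀, hlow⟩ := hK.exists_lower_bound
  have hQ := hω.ergodic.toMeasurePreserving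
  obtain ⟨C, r, hC, hr0, hr1, hCr⟩ := exists_le_of_not_infiniteDisorder hdis
  have hE : ∀ E : Finset ℕ, (P.map (fun a i => ω i a)).real (plusSet E) ≤ C * r ^ E.card := by
    intro E
    have h1 := measure_plusSet_le (Q := P.map (fun a i => ω i a))
      (by simp only [hω.map_plusSet]; exact hcorr) hQ E
    refine (ENNReal.toReal_mono (measure_ne_top _ _) h1).trans ?_
    rw [hω.map_plusSet]
    exact hCr E.card
  set q := Real.exp (-(2 * β)) with hq
  have hq1 : q < 1 := Real.exp_lt_one_iff.2 (by linarith)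
  have hρ0 : 0 < (1 - q) * r + q := by
    have : 0 < q := Real.exp_pos _
    have : 0 < (1 - q) * r := mul_pos (by linarith) hr0
    linarith
  have hρ1 : (1 - q) * r + q < 1 := by nlinarith
  -- The number (1 - q) r + q is a convex combination of r < 1 and 1; this ε makes the annealed
  -- weight per contact exactly 1.
  refine ⟨-Real.log ((1 - q) * r + q), neg_pos.2 (Real.log_neg hρ0 hρ1), fun h hh => ?_⟩
  have hbd := hω.ae_abs_le β h
  refine freeEnergy_eq_of_tendsto hω hK.zero (tendsto_integral_log_zero hbd hK.zero hc hn₀ hlow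
    (C := C) (integral_partitionFunction_le hbd
      (integral_prod_exp_le (ε := -Real.log ((1 - q) * r + q)) hr0.le hβ hq ?_ (by linarith) hC.le hω.ae_values hE)))
  rw [Real.exp_neg, Real.exp_log hρ0, inv_mul_cancel₀ hρ0.ne']

lemma criticalPoint_eq (hK : IsInterArrival K) (hdis : InfiniteDisorder P ω) (hβ : 0 < β) :
    criticalPoint K P ω β = ((-β : ℝ) : EReal) := by
  have hset : {h : ℝ | 0 < freeEnergy K P ω β h} = Set.Ioi (-β) := by
    ext h
    simp only [Set.mem_ofPred_eq, Set.mem_Ioi]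
    refine ⟨fun H => ?_, fun H => freeEnergy_pos hω hK hdis (by linarith)⟩
    by_contra! hle
    exact H.ne' (freeEnergy_eq_zero_of_le hω hK hβ hle)
  rw [criticalPoint, hset]
  refine (isGLB_iff_sInf_eq.1 ⟨?_, fun b hb => ?_⟩)
  · rintro _ ⟨h, hh, rfl⟩
    exact EReal.coe_le_coe_iff.2 (le_of_lt hh)
  · by_contra! hlt
    obtain ⟨x, hx1, hx2⟩ := EReal.lt_iff_exists_real_btwn.1 hlt
    exact (hb ⟨x, EReal.coe_lt_coe_iff.1 hx1, rfl⟩).not_gt hx2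

lemma lt_criticalPoint (hcorr : NonIncreasingCorrelations P ω) (hK : IsInterArrival K)
    (hdis : ¬ InfiniteDisorder P ω) (hβ : 0 < β) :
    ((-β : ℝ) : EReal) < criticalPoint K P ω β := by
  obtain ⟨ε, hε, hzero⟩ := exists_freeEnergy_eq_zero hω hcorr hK hdis hβ
  refine (EReal.coe_lt_coe_iff.2 (show -β < -β + ε by linarith)).trans_le (le_sInf ?_)
  rintro _ ⟨h, hh, rfl⟩
  refine EReal.coe_le_coe_iff.2 (le_of_not_ge fun hle => ?_)
  exact (ne_of_gt hh) (hzero h hle)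

end

end Pinning

end

theorem theorem2p3 {Ω : Type*} [MeasurableSpace Ω] (P : Measure Ω) [IsProbabilityMeasure P]
    (ω : ℕ → Ω → ℝ) (hω : Pinning.IsEnvironment P ω)
    (hcorr : Pinning.NonIncreasingCorrelations P ω)
    (K : PMF ℕ) (hK : Pinning.IsInterArrival K) :
    ((∀ β : ℝ, 0 < β → Pinning.criticalPoint K P ω β = ((-β : ℝ) : EReal)) ↔
      Pinning.InfiniteDisorder P ω) ∧
    (¬ Pinning.InfiniteDisorder P ω →
      ∀ β : ℝ, 0 < β → ((-β : ℝ) : EReal) < Pinning.criticalPoint K P ω β) := by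
  have hlt := fun (hdis : ¬ Pinning.InfiniteDisorder P ω) (β : ℝ) (hβ : 0 < β) =>
    Pinning.lt_criticalPoint hω hcorr hK hdis hβ
  refine ⟨⟨fun H => ?_, fun hdis β hβ => Pinning.criticalPoint_eq hω hK hdis hβ⟩, hlt⟩
  by_contra hdis
  -- Equality at a single β already contradicts the strict inequality valid for all β.
  exact (hlt hdis 1 one_pos).ne' (H 1 one_pos)
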